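/- Let $\Gamma=\mathbb Q^2\rtimes G$ with $G=SL_2(\mathbb Q)$ acting on $\mathbb Q^2$ by matrix multiplication, let $L(\Gamma)$ be the group von Neumann algebra generated by the canonical unitaries $u_\gamma$ ($\gamma\in\Gamma$) of the left regular representation on $\ell^2(\Gamma)$, and let $L(\mathbb Q^2),L(G)\subseteq L(\Gamma)$ be the von Neumann subalgebras generated by $\{u_v\}_{v\in\mathbb Q^2}$ and $\{u_g\}_{g\in G}$. Let $A\subseteq L(\mathbb Q^2)$ be the von Neumann subalgebra of all elements with Fourier expansion $\sum_{v\in\mathbb Q^2}c_vu_v$ such that $c_v=c_{-v}$ for all $v\in\mathbb Q^2$, and let $A\rtimes G\subseteq L(\mathbb Q^2)\rtimes G=L(\Gamma)$ be the crossed product by the conjugation action of $G$, that is, the von Neumann subalgebra of $L(\Gamma)$ generated by $A$ and $\{u_g\}_{g\in G}$. Put $q=\frac{u_{id}+u_{-id}}{2}$, where $id\in G$ is the identity matrix. Then $q$ is a central projection in $A\rtimes G$, and every von Neumann algebra $P$ with $L(G)\subseteq P\subseteq A\rtimes G$ satisfies $$P\in\Big\{L(G),\ A\rtimes G,\ qL(G)\oplus(1-q)(A\rtimes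 G),\ (1-q)L(G)\oplus q(A\rtimes G)\Big\}.$$ -/

import Mathlib

/-- The Hilbert space `ℓ²(Γ)` of a discrete group `Γ`. -/
abbrev EllTwo (Γ : Type*) : Type _ := lp (fun _ : Γ => ℂ) 2

/-- The canonical unitary `u_γ` of the left regular representation of `Γ`:
`(u_γ ξ)(h) = ξ(γ⁻¹ h)`, so that `u_γ δ_h = δ_{γ h}`. -/
noncomputable def leftRegularOp {Γ : Type*} [Group Γ] (γ : Γ) :
    EllTwo Γ →L[ℂ] EllTwo Γ :=
  LinearIsometry.toContinuousLinearMap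
    { toFun := fun ξ => ⟨fun h => ξ (γ⁻¹ * h), by
        have hξ := (memℓp_gen_iff (by norm_num)).1 (lp.memℓp ξ)
        exact memℓp_gen ((Equiv.mulLeft γ⁻¹).summable_iff.2 hξ)⟩
      map_add' := fun _ _ => rfl
      map_smul' := fun _ _ => rfl
      norm_map' := fun ξ => by
        rw [lp.norm_eq_tsum_rpow (by norm_num), lp.norm_eq_tsum_rpow (by norm_num)]
        congr 1
        exact (Equiv.mulLeft γ⁻¹).tsum_eq (fun h => ‖ξ h‖ ^ (2 : ENNReal).toReal) }

/-- The von Neumann algebra generated by a set `S` of bounded operators on a Hilbert space: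
the double commutant of `S ∪ S*`. -/
noncomputable def generatedVN {H : Type*} [NormedAddCommGroup H] [InnerProductSpace ℂ H]
    [CompleteSpace H] (S : Set (H →L[ℂ] H)) : VonNeumannAlgebra H where
  toStarSubalgebra :=
    StarSubalgebra.centralizer ℂ (StarSubalgebra.centralizer ℂ S : Set (H →L[ℂ] H))
  centralizer_centralizer' := by
    change Set.centralizer (Set.centralizer (StarSubalgebra.centralizer ℂ
      (StarSubalgebra.centralizer ℂ S : Set (H →L[ℂ] H)) : Set (H →L[ℂ] H))) =
      (StarSubalgebra.centralizer ℂ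
        (StarSubalgebra.centralizer ℂ S : Set (H →L[ℂ] H)) : Set (H →L[ℂ] H))
    rw [StarSubalgebra.coe_centralizer_centralizer, Set.centralizer_centralizer_centralizer]

/-- The Fourier coefficient `c_γ` of an operator `x` on `ℓ²(Γ)`, i.e. `⟨x δ_e, δ_γ⟩`. An element `x`
of `L(Γ)` has the Fourier expansion `x = ∑ c_γ u_γ`. -/
noncomputable def groupFourierCoeff {Γ : Type*} [Group Γ] (x : EllTwo Γ →L[ℂ] EllTwo Γ)
    (γ : Γ) : ℂ :=
  letI := Classical.decEq Γ
  (x (lp.single 2 (1 : Γ) (1 : ℂ)) : Γ → ℂ) γ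

/-- The group `SL₂(ℚ)`. -/
abbrev SL2Q : Type := Matrix.SpecialLinearGroup (Fin 2) ℚ

/-- The action of `SL₂(ℚ)` on `ℚ²` by matrix multiplication from the left. -/
def sl2QAction : SL2Q →* MulAut (Multiplicative (Fin 2 → ℚ)) where
  toFun g := AddEquiv.toMultiplicative (Matrix.SpecialLinearGroup.toLin' g).toAddEquiv
  map_one' := by
    ext v : 1
    exact congrArg Multiplicative.ofAdd
      (LinearEquiv.congr_fun (map_one Matrix.SpecialLinearGroup.toLin') v.toAdd)
  map_mul' g h := by
    ext v : 1
    exact congrArg Multiplicative.ofAdd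
      (LinearEquiv.congr_fun (map_mul Matrix.SpecialLinearGroup.toLin' g h) v.toAdd)

/-- The group `ℚ² ⋊ SL₂(ℚ)`. -/
abbrev AffineSL2Q : Type := Multiplicative (Fin 2 → ℚ) ⋊[sl2QAction] SL2Q

/-- The element of `ℚ² ⋊ SL₂(ℚ)` given by `v ∈ ℚ²`. -/
def translation (v : Fin 2 → ℚ) : AffineSL2Q := SemidirectProduct.inl (Multiplicative.ofAdd v)

/-- The canonical unitary `u_v`, `v ∈ ℚ²`, in `L(ℚ² ⋊ SL₂(ℚ))`. -/
noncomputable def uVec (v : Fin 2 → ℚ) : EllTwo AffineSL2Q →L[ℂ] EllTwo AffineSL2Q :=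
  leftRegularOp (translation v)

/-- The canonical unitary `u_g`, `g ∈ SL₂(ℚ)`, in `L(ℚ² ⋊ SL₂(ℚ))`. -/
noncomputable def uMat (g : SL2Q) : EllTwo AffineSL2Q →L[ℂ] EllTwo AffineSL2Q :=
  leftRegularOp (SemidirectProduct.inr g)

/-- `L(ℚ²)`, as a von Neumann subalgebra of `L(ℚ² ⋊ SL₂(ℚ))`. -/
noncomputable def LQ2 : VonNeumannAlgebra (EllTwo AffineSL2Q) :=
  generatedVN (Set.range uVec)

/-- `L(G)` for `G = SL₂(ℚ)`, as a von Neumann subalgebra of `L(ℚ² ⋊ SL₂(ℚ))`. -/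
noncomputable def LSL2Q : VonNeumannAlgebra (EllTwo AffineSL2Q) :=
  generatedVN (Set.range uMat)

/-- The set `A` of all `∑ c_v u_v` in `L(ℚ²)` such that `c_v = c_{-v}` for all `v ∈ ℚ²`. -/
def symmetricPart : Set (EllTwo AffineSL2Q →L[ℂ] EllTwo AffineSL2Q) :=
  {a | a ∈ LQ2 ∧
    ∀ v : Fin 2 → ℚ, groupFourierCoeff a (translation v) = groupFourierCoeff a (translation (-v))}

/-- The crossed product `A ⋊ G` of `A` by the conjugation action `a ↦ u_g a u_g*` of `G = SL₂(ℚ)`,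
as a von Neumann subalgebra of `L(ℚ²) ⋊ G = L(ℚ² ⋊ G)`: it is generated by `A` and the
unitaries `u_g`. On `ℓ²(ℚ² ⋊ G) = ℓ²(ℚ²) ⊗ ℓ²(G)` an element `a ∈ L(ℚ²)` acts as `a ⊗ 1` and `u_g`
acts as `U_g ⊗ λ_g`, where `U_g δ_v = δ_{g v}` and `λ` is the left regular representation, so this
is the usual crossed product for the action `Ad U_g` of `G` on `A`. -/
noncomputable def crossedProduct : VonNeumannAlgebra (EllTwo AffineSL2Q) :=
  generatedVN (symmetricPart ∪ Set.range uMat)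

/-- The element `q = (u_id + u_{-id}) / 2`. -/
noncomputable def qProj : EllTwo AffineSL2Q →L[ℂ] EllTwo AffineSL2Q :=
  (1 / 2 : ℂ) • (uMat 1 + uMat (-1))

/-- The set `p M ⊕ (1 - p) N` of all operators `p x + (1 - p) y` with `x ∈ M` and `y ∈ N`. -/
def cornerSum {H : Type*} [NormedAddCommGroup H] [InnerProductSpace ℂ H] [CompleteSpace H]
    (p : H →L[ℂ] H) (M N : VonNeumannAlgebra H) : Set (H →L[ℂ] H) :=
  {z | ∃ x ∈ M, ∃ y ∈ N, z = p * x + (1 - p) * y}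

/-! Let `e_P` be the orthogonal projection of `ℓ²(Γ)` onto the closure of `P δ_e`; it implements the
conditional expectation onto `P`, and since `P` contains `L(G)` it is determined by the vectors `e_P
δ_v`, `v ∈ ℚ²`. These are covariant under conjugation by `G`, so the coefficients of `e_P δ_v` are
constant on orbits of the stabilizer of `v`. Square summability leaves only coefficients at `(t v,
h)` with `h v = ±v` (`projVec_support`).

The element `u_{-id}` is central in `A ⋊ G`, so the problem splits along the projections `(1 + σ
u_{-id}) / 2` with `σ = ±1`. On a corner, `e_P (u_{e₂} ξ)` for `ξ = (1 + σ u_{-id}) e_P δ_{e₁}` is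
computed twice: as a convolution of `e_P δ_{e₂}` with `ξ` (right `P`-modularity), and by expanding
`ξ` in the basis and projecting term by term. The first gives products of coefficients; the second
is restricted by the support lemma. Comparison removes the nontrivial unipotents
(`signVec_upperUnip_eq_zero`) and gives a multiplicative relation for the coefficients at `(t e₁,
id)`, which forces `t = ±1` (`signVec_diag_support`).

So on each corner `e_P δ_v` is a multiple of the symmetrization of `δ_v`, and idempotence of `e_P`
leaves two possibilities: zero, or exactly the symmetrization (`signProj_projVec_dichotomy`). In the
first case the corner of `P` is that of `L(G)`, in the second that of `A ⋊ G`. Two corners with two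
options each give the four algebras. -/

open scoped InnerProductSpace

/-! ### Basis vectors and the two regular representations of a discrete group -/

section GroupGeneralities

variable {Γ : Type*}

/-- The canonical basis vector `δ_γ` of `ℓ²(Γ)`. -/
noncomputable def deltaVec (γ : Γ) : EllTwo Γ :=
  letI := Classical.decEq Γ
  lp.single 2 γ (1 : ℂ)

open Classical in
theorem deltaVec_apply (γ h : Γ) : deltaVec γ h = if h = γ then 1 else 0 := by
  unfold deltaVec
  rw [lp.single_apply, Pi.single_apply]

@[simp]
theorem deltaVec_self (γ : Γ) : deltaVec γ γ = 1 := by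
  classical
  rw [deltaVec_apply, if_pos rfl]

theorem deltaVec_of_ne {γ h : Γ} (hne : h ≠ γ) : deltaVec γ h = 0 := by
  classical
  rw [deltaVec_apply, if_neg hne]

theorem inner_deltaVec_left (γ : Γ) (ξ : EllTwo Γ) : ⟪deltaVec γ, ξ⟫_ℂ = ξ γ := by
  let := Classical.decEq Γ
  rw [deltaVec, lp.inner_single_left]
  simp

theorem inner_deltaVec_right (γ : Γ) (ξ : EllTwo Γ) :
    ⟪ξ, deltaVec γ⟫_ℂ = starRingEnd ℂ (ξ γ) := by
  rw [← inner_conj_symm, inner_deltaVec_left]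

theorem hasSum_deltaVec (ξ : EllTwo Γ) : HasSum (fun γ => ξ γ • deltaVec γ) ξ := by
  classical
  have h := lp.hasSum_single (p := 2) (by norm_num) ξ
  refine h.congr_fun fun γ => ?_
  ext k
  by_cases hk : k = γ
  · subst hk; simp
  · rw [lp.single_apply_ne _ _ _ hk]
    simp [deltaVec_of_ne hk]

theorem mem_of_forall_deltaVec_mem (S : Submodule ℂ (EllTwo Γ))
    (hS : IsClosed (S : Set (EllTwo Γ))) (h : ∀ γ, deltaVec γ ∈ S) (ξ : EllTwo Γ) : ξ ∈ S :=
  hS.mem_of_tendsto (hasSum_deltaVec ξ)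
    (Filter.Eventually.of_forall fun _ => S.sum_mem fun γ _ => S.smul_mem _ (h γ))

theorem ellTwo_clm_ext {F : Type*} [NormedAddCommGroup F] [NormedSpace ℂ F]
    {S T : EllTwo Γ →L[ℂ] F} (h : ∀ γ, S (deltaVec γ) = T (deltaVec γ)) : S = T := by
  ext1 ξ
  have := mem_of_forall_deltaVec_mem (S - T).ker (S - T).isClosed_ker
    (fun γ => by simp [h γ]) ξ
  simpa [sub_eq_zero] using this

theorem summable_norm_sq_coeff (ξ : EllTwo Γ) : Summable fun γ => ‖ξ γ‖ ^ 2 := by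
  have h := (memℓp_gen_iff (p := 2) (by norm_num)).1 (lp.memℓp ξ)
  simpa using h

/-- A square-summable family cannot take one nonzero value infinitely often. This is the only
analytic input to the support computations; it is used for conjugation orbits and for powers of a
rational. -/
theorem coeff_eq_zero_of_injective {ξ : EllTwo Γ} {γ : Γ} {f : ℕ → Γ}
    (hf : Function.Injective f) (h : ∀ n, ξ (f n) = ξ γ) : ξ γ = 0 := by
  have h1 := (summable_norm_sq_coeff ξ).comp_injective hf
  have h2 := h1.tendsto_atTop_zero
  simp only [Function.comp_def, h] at h2
  have h3 := tendsto_nhds_unique h2 tendsto_const_nhds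
  simpa using h3.symm

variable [Group Γ]

@[simp]
theorem leftRegularOp_apply (γ h : Γ) (ξ : EllTwo Γ) : leftRegularOp γ ξ h = ξ (γ⁻¹ * h) := rfl

theorem leftRegularOp_deltaVec (γ h : Γ) : leftRegularOp γ (deltaVec h) = deltaVec (γ * h) := by
  classical
  ext k
  simp [deltaVec_apply, inv_mul_eq_iff_eq_mul]

/-- The right regular representation: `(ρ_γ ξ)(h) = ξ(h γ)`, so that `ρ_γ δ_h = δ_{h γ⁻¹}`. -/
noncomputable def rightRegularOp (γ : Γ) : EllTwo Γ →L[ℂ] EllTwo Γ :=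
  LinearIsometry.toContinuousLinearMap
    { toFun := fun ξ => ⟨fun h => ξ (h * γ), by
        have hξ := (memℓp_gen_iff (by norm_num)).1 (lp.memℓp ξ)
        exact memℓp_gen ((Equiv.mulRight γ).summable_iff.2 hξ)⟩
      map_add' := fun _ _ => rfl
      map_smul' := fun _ _ => rfl
      norm_map' := fun ξ => by
        rw [lp.norm_eq_tsum_rpow (by norm_num), lp.norm_eq_tsum_rpow (by norm_num)]
        congr 1
        exact (Equiv.mulRight γ).tsum_eq (fun h => ‖ξ h‖ ^ (2 : ENNReal).toReal) }

@[simp]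
theorem rightRegularOp_apply (γ h : Γ) (ξ : EllTwo Γ) : rightRegularOp γ ξ h = ξ (h * γ) := rfl

theorem rightRegularOp_deltaVec (γ h : Γ) :
    rightRegularOp γ (deltaVec h) = deltaVec (h * γ⁻¹) := by
  classical
  ext k
  simp [deltaVec_apply, eq_mul_inv_iff_mul_eq]

theorem star_rightRegularOp (γ : Γ) : star (rightRegularOp γ) = rightRegularOp γ⁻¹ := by
  rw [ContinuousLinearMap.star_eq_adjoint, eq_comm]
  refine ellTwo_clm_ext fun h => ?_
  ext k
  rw [← inner_deltaVec_left k, ← inner_deltaVec_left k, ContinuousLinearMap.adjoint_inner_right]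
  simp only [rightRegularOp_deltaVec, inner_deltaVec_left, deltaVec_apply, inv_inv]
  congr 1
  exact propext mul_inv_eq_iff_eq_mul.symm

theorem star_leftRegularOp (γ : Γ) : star (leftRegularOp γ) = leftRegularOp γ⁻¹ := by
  rw [ContinuousLinearMap.star_eq_adjoint, eq_comm]
  refine ellTwo_clm_ext fun h => ?_
  ext k
  rw [← inner_deltaVec_left k, ← inner_deltaVec_left k, ContinuousLinearMap.adjoint_inner_right]
  simp only [leftRegularOp_deltaVec, inner_deltaVec_left, deltaVec_apply]
  congr 1
  simp [eq_inv_mul_iff_mul_eq]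

theorem leftRegularOp_mul (γ h : Γ) :
    leftRegularOp γ * leftRegularOp h = leftRegularOp (γ * h) := by
  refine ellTwo_clm_ext fun k => ?_
  simp [leftRegularOp_deltaVec, mul_assoc]

theorem leftRegularOp_one : leftRegularOp (1 : Γ) = 1 := by
  refine ellTwo_clm_ext fun k => ?_
  simp [leftRegularOp_deltaVec]

/-! ### The commutant of right translations and the modular conjugation -/

variable (Γ) in
/-- The commutant of the right regular representation. -/
noncomputable def rightCommutant : StarSubalgebra ℂ (EllTwo Γ →L[ℂ] EllTwo Γ) :=
  StarSubalgebra.centralizer ℂ (Set.range rightRegularOp)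

theorem mem_rightCommutant_iff {x : EllTwo Γ →L[ℂ] EllTwo Γ} :
    x ∈ rightCommutant Γ ↔ ∀ γ ξ, x (rightRegularOp γ ξ) = rightRegularOp γ (x ξ) := by
  rw [rightCommutant, StarSubalgebra.mem_centralizer_iff]
  constructor
  · intro h γ ξ
    exact (congrArg (fun T => T ξ) (h _ ⟨γ, rfl⟩).1).symm
  · rintro h _ ⟨γ, rfl⟩
    rw [star_rightRegularOp]
    exact ⟨ContinuousLinearMap.ext fun ξ => (h γ ξ).symm,
      ContinuousLinearMap.ext fun ξ => (h γ⁻¹ ξ).symm⟩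

theorem leftRegularOp_mem_rightCommutant (γ : Γ) : leftRegularOp γ ∈ rightCommutant Γ := by
  rw [mem_rightCommutant_iff]
  intro h ξ
  ext k
  simp [mul_assoc]

theorem apply_deltaVec_of_mem_rightCommutant {x : EllTwo Γ →L[ℂ] EllTwo Γ}
    (hx : x ∈ rightCommutant Γ) (γ : Γ) :
    x (deltaVec γ) = rightRegularOp γ⁻¹ (x (deltaVec 1)) := by
  rw [← mem_rightCommutant_iff.1 hx, rightRegularOp_deltaVec]
  simp

theorem apply_deltaVec_apply_of_mem_rightCommutant {x : EllTwo Γ →L[ℂ] EllTwo Γ}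
    (hx : x ∈ rightCommutant Γ) (γ h : Γ) :
    x (deltaVec γ) h = x (deltaVec 1) (h * γ⁻¹) := by
  rw [apply_deltaVec_of_mem_rightCommutant hx, rightRegularOp_apply]

theorem rightCommutant_ext {x y : EllTwo Γ →L[ℂ] EllTwo Γ} (hx : x ∈ rightCommutant Γ)
    (hy : y ∈ rightCommutant Γ) (h : x (deltaVec 1) = y (deltaVec 1)) : x = y :=
  ellTwo_clm_ext fun γ => by
    rw [apply_deltaVec_of_mem_rightCommutant hx, apply_deltaVec_of_mem_rightCommutant hy, h]

variable (Γ) in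
/-- The conjugate-linear isometry `(J ξ)(h) = conj (ξ (h⁻¹))` of `ℓ²(Γ)`. -/
noncomputable def modularConj : EllTwo Γ →ₛₗᵢ[starRingEnd ℂ] EllTwo Γ where
  toFun := fun ξ => ⟨fun h => starRingEnd ℂ (ξ h⁻¹), by
    have hξ := (memℓp_gen_iff (by norm_num)).1 (lp.memℓp ξ)
    refine memℓp_gen ?_
    simpa [Function.comp_def] using (Equiv.inv Γ).summable_iff.2 hξ⟩
  map_add' := fun ξ η => by ext h; exact map_add (starRingEnd ℂ) _ _
  map_smul' := fun c ξ => by ext h; exact map_mul (starRingEnd ℂ) _ _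
  norm_map' := fun ξ => by
    rw [lp.norm_eq_tsum_rpow (by norm_num), lp.norm_eq_tsum_rpow (by norm_num)]
    congr 1
    simpa using (Equiv.inv Γ).tsum_eq (fun h => ‖ξ h‖ ^ (2 : ENNReal).toReal)

@[simp]
theorem modularConj_apply (ξ : EllTwo Γ) (h : Γ) :
    modularConj Γ ξ h = starRingEnd ℂ (ξ h⁻¹) := rfl

@[simp]
theorem modularConj_modularConj (ξ : EllTwo Γ) : modularConj Γ (modularConj Γ ξ) = ξ := by
  ext h
  simp

theorem modularConj_deltaVec (γ : Γ) : modularConj Γ (deltaVec γ) = deltaVec γ⁻¹ := by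
  classical
  ext k
  simp [deltaVec_apply, inv_eq_iff_eq_inv, apply_ite]

theorem inner_modularConj_left (ξ η : EllTwo Γ) :
    ⟪modularConj Γ ξ, η⟫_ℂ = ⟪modularConj Γ η, ξ⟫_ℂ := by
  rw [lp.inner_eq_tsum, lp.inner_eq_tsum, ← (Equiv.inv Γ).tsum_eq]
  refine tsum_congr fun h => ?_
  simp [mul_comm]

/-- The matrix entry of `x` at `(h, γ)` depends only on `h γ⁻¹`, so passing to the adjoint inverts
the group element and conjugates the coefficient. -/
theorem modularConj_apply_deltaVec_one {x : EllTwo Γ →L[ℂ] EllTwo Γ}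
    (hx : x ∈ rightCommutant Γ) :
    modularConj Γ (x (deltaVec 1)) = star x (deltaVec 1) := by
  ext h
  rw [← inner_deltaVec_left h (star x _), ContinuousLinearMap.star_eq_adjoint,
    ContinuousLinearMap.adjoint_inner_right, inner_deltaVec_right,
    apply_deltaVec_apply_of_mem_rightCommutant hx]
  simp

/-! ### The closure of `P δ_e` and recovery of `P` from it -/

/-- The closure of `P δ_e` in `ℓ²(Γ)`. -/
noncomputable def cyclicSubspace (P : VonNeumannAlgebra (EllTwo Γ)) : Submodule ℂ (EllTwo Γ) :=
  (P.toStarSubalgebra.toSubalgebra.toSubmodule.map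
    (ContinuousLinearMap.apply ℂ (EllTwo Γ) (deltaVec (1 : Γ))).toLinearMap).topologicalClosure

noncomputable instance (P : VonNeumannAlgebra (EllTwo Γ)) : CompleteSpace (cyclicSubspace P) :=
  inferInstanceAs (CompleteSpace (Submodule.topologicalClosure _))

theorem isClosed_cyclicSubspace (P : VonNeumannAlgebra (EllTwo Γ)) :
    IsClosed (cyclicSubspace P : Set (EllTwo Γ)) :=
  Submodule.isClosed_topologicalClosure _

theorem apply_mem_cyclicSubspace {P : VonNeumannAlgebra (EllTwo Γ)}
    {x : EllTwo Γ →L[ℂ] EllTwo Γ} (hx : x ∈ P) : x (deltaVec 1) ∈ cyclicSubspace P :=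
  subset_closure ⟨x, hx, rfl⟩

theorem cyclicSubspace_induction {P : VonNeumannAlgebra (EllTwo Γ)} {p : EllTwo Γ → Prop}
    (hp : IsClosed {ξ | p ξ}) (h : ∀ x ∈ P, p (x (deltaVec 1))) {ξ : EllTwo Γ}
    (hξ : ξ ∈ cyclicSubspace P) : p ξ := by
  have : closure ((fun x : EllTwo Γ →L[ℂ] EllTwo Γ => x (deltaVec (1 : Γ))) ''
      (P : Set (EllTwo Γ →L[ℂ] EllTwo Γ))) ⊆
      {ξ | p ξ} :=
    closure_minimal (by rintro _ ⟨x, hx, rfl⟩; exact h x hx) hp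
  exact this hξ

theorem mem_cyclicSubspace_of_continuous {P Q : VonNeumannAlgebra (EllTwo Γ)}
    {f : EllTwo Γ → EllTwo Γ} (hf : Continuous f)
    (h : ∀ x ∈ P, f (x (deltaVec 1)) ∈ cyclicSubspace Q) {ξ : EllTwo Γ}
    (hξ : ξ ∈ cyclicSubspace P) : f ξ ∈ cyclicSubspace Q :=
  cyclicSubspace_induction (p := fun ξ => f ξ ∈ cyclicSubspace Q)
    ((isClosed_cyclicSubspace Q).preimage hf) h hξ

theorem cyclicSubspace_mono {P Q : VonNeumannAlgebra (EllTwo Γ)} (h : P ≤ Q) :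
    cyclicSubspace P ≤ cyclicSubspace Q := fun _ hξ =>
  mem_cyclicSubspace_of_continuous continuous_id (fun _ hx => apply_mem_cyclicSubspace (h hx)) hξ

theorem modularConj_mem_cyclicSubspace {P : VonNeumannAlgebra (EllTwo Γ)}
    (hP : ∀ x ∈ P, x ∈ rightCommutant Γ) {ξ : EllTwo Γ} (hξ : ξ ∈ cyclicSubspace P) :
    modularConj Γ ξ ∈ cyclicSubspace P :=
  mem_cyclicSubspace_of_continuous (modularConj Γ).continuous (fun x hx => by
    rw [modularConj_apply_deltaVec_one (hP x hx)]
    exact apply_mem_cyclicSubspace (star_mem hx)) hξ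

theorem mul_mem_cyclicSubspace {P : VonNeumannAlgebra (EllTwo Γ)}
    {y : EllTwo Γ →L[ℂ] EllTwo Γ} (hy : y ∈ P) {ξ : EllTwo Γ} (hξ : ξ ∈ cyclicSubspace P) :
    y ξ ∈ cyclicSubspace P :=
  mem_cyclicSubspace_of_continuous y.continuous
    (fun x hx => apply_mem_cyclicSubspace (x := y * x) (mul_mem hy hx)) hξ

/-- An operator commuting with the right translations belongs to `P` as soon as its value at `δ_e`
is in the closure of `P δ_e`. -/
theorem mem_of_apply_mem_cyclicSubspace {P : VonNeumannAlgebra (EllTwo Γ)}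
    (hP : ∀ x ∈ P, x ∈ rightCommutant Γ) {y : EllTwo Γ →L[ℂ] EllTwo Γ}
    (hy : y ∈ rightCommutant Γ) (h : y (deltaVec 1) ∈ cyclicSubspace P) : y ∈ P := by
  rw [← P.commutant_commutant, VonNeumannAlgebra.mem_commutant_iff]
  intro S hS
  rw [VonNeumannAlgebra.mem_commutant_iff] at hS
  refine ellTwo_clm_ext fun γ => ?_
  ext k
  -- For `ξ = x δ_e` with `x ∈ P` this says `⟨δ_k, S x δ_γ⟩ = ⟨x* δ_k, S δ_γ⟩`, that is, `S x = x
  -- S`. Written in terms of `ξ` and `J ξ` alone, both sides are continuous, so it passes to the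
  -- closure and applies to `y δ_e`.
  have key : ∀ ξ ∈ cyclicSubspace P,
      ⟪deltaVec k, S (rightRegularOp γ⁻¹ ξ)⟫_ℂ =
        ⟪rightRegularOp k⁻¹ (modularConj Γ ξ), S (deltaVec γ)⟫_ℂ := by
    intro ξ hξ
    refine cyclicSubspace_induction (p := fun ξ => ⟪deltaVec k, S (rightRegularOp γ⁻¹ ξ)⟫_ℂ =
        ⟪rightRegularOp k⁻¹ (modularConj Γ ξ), S (deltaVec γ)⟫_ℂ) ?_ ?_ hξ
    · have hc := (modularConj Γ).continuous
      exact isClosed_eq (by fun_prop) (by fun_prop)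
    · intro x hx
      rw [← apply_deltaVec_of_mem_rightCommutant (hP x hx),
        modularConj_apply_deltaVec_one (hP x hx),
        ← apply_deltaVec_of_mem_rightCommutant (star_mem (hP x hx)),
        ContinuousLinearMap.star_eq_adjoint, ContinuousLinearMap.adjoint_inner_left]
      exact congrArg (fun T : EllTwo Γ →L[ℂ] EllTwo Γ => ⟪deltaVec k, T (deltaVec γ)⟫_ℂ)
        (hS x hx).symm
  have := key _ h
  rw [← apply_deltaVec_of_mem_rightCommutant hy, modularConj_apply_deltaVec_one hy,
        ← apply_deltaVec_of_mem_rightCommutant (star_mem hy),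
        ContinuousLinearMap.star_eq_adjoint, ContinuousLinearMap.adjoint_inner_left,
        inner_deltaVec_left, inner_deltaVec_left] at this
  exact this

/-! ### The projection `e_P` as a `P`-bimodule map -/

/-- The orthogonal projection of `ℓ²(Γ)` onto the closure of `P δ_e`. -/
noncomputable def cyclicProj (P : VonNeumannAlgebra (EllTwo Γ)) : EllTwo Γ →L[ℂ] EllTwo Γ :=
  (cyclicSubspace P).starProjection

theorem cyclicProj_mem (P : VonNeumannAlgebra (EllTwo Γ)) (ξ : EllTwo Γ) :
    cyclicProj P ξ ∈ cyclicSubspace P :=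
  Submodule.starProjection_apply_mem _ _

theorem cyclicProj_eq_self {P : VonNeumannAlgebra (EllTwo Γ)} {ξ : EllTwo Γ}
    (hξ : ξ ∈ cyclicSubspace P) : cyclicProj P ξ = ξ :=
  Submodule.starProjection_eq_self_iff.2 hξ

theorem inner_cyclicProj_left (P : VonNeumannAlgebra (EllTwo Γ)) (ξ η : EllTwo Γ) :
    ⟪cyclicProj P ξ, η⟫_ℂ = ⟪ξ, cyclicProj P η⟫_ℂ :=
  Submodule.inner_starProjection_left_eq_right _ _ _

/-- The projection onto a subspace invariant under `T` and `T*` commutes with `T`. -/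
theorem cyclicProj_commute {P : VonNeumannAlgebra (EllTwo Γ)} {T : EllTwo Γ →L[ℂ] EllTwo Γ}
    (hT : ∀ ξ ∈ cyclicSubspace P, T ξ ∈ cyclicSubspace P)
    (hT' : ∀ ξ ∈ cyclicSubspace P, star T ξ ∈ cyclicSubspace P) (ξ : EllTwo Γ) :
    cyclicProj P (T ξ) = T (cyclicProj P ξ) := by
  refine (Submodule.eq_starProjection_of_mem_of_inner_eq_zero (hT _ (cyclicProj_mem P ξ)) ?_)
  intro η hη
  rw [← map_sub, ← ContinuousLinearMap.adjoint_inner_right]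
  exact Submodule.starProjection_inner_eq_zero _ _ (hT' _ hη)

theorem cyclicProj_mul {P : VonNeumannAlgebra (EllTwo Γ)} {y : EllTwo Γ →L[ℂ] EllTwo Γ}
    (hy : y ∈ P) (ξ : EllTwo Γ) : cyclicProj P (y ξ) = y (cyclicProj P ξ) :=
  cyclicProj_commute (fun _ h => mul_mem_cyclicSubspace hy h)
    (fun _ h => mul_mem_cyclicSubspace (star_mem hy) h) ξ

theorem cyclicProj_modularConj {P : VonNeumannAlgebra (EllTwo Γ)}
    (hP : ∀ x ∈ P, x ∈ rightCommutant Γ) (ξ : EllTwo Γ) :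
    cyclicProj P (modularConj Γ ξ) = modularConj Γ (cyclicProj P ξ) := by
  refine (Submodule.eq_starProjection_of_mem_of_inner_eq_zero
    (modularConj_mem_cyclicSubspace hP (cyclicProj_mem P ξ)) ?_)
  intro η hη
  rw [← map_sub, inner_modularConj_left, ← inner_conj_symm]
  exact (congrArg (starRingEnd ℂ) (Submodule.starProjection_inner_eq_zero _ _
    (modularConj_mem_cyclicSubspace hP hη))).trans (map_zero _)

theorem rightRegularOp_eq_modularConj (γ : Γ) (ξ : EllTwo Γ) :
    rightRegularOp γ ξ = modularConj Γ (leftRegularOp γ (modularConj Γ ξ)) := by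
  ext h
  simp

/-- Right translation is left translation conjugated by `J`, and `e_P` commutes with `J` and with
left multiplication by `P`. -/
theorem cyclicProj_rightRegularOp {P : VonNeumannAlgebra (EllTwo Γ)}
    (hP : ∀ x ∈ P, x ∈ rightCommutant Γ) {γ : Γ} (hγ : leftRegularOp γ ∈ P) (ξ : EllTwo Γ) :
    cyclicProj P (rightRegularOp γ ξ) = rightRegularOp γ (cyclicProj P ξ) := by
  rw [rightRegularOp_eq_modularConj, cyclicProj_modularConj hP, cyclicProj_mul hγ,
    cyclicProj_modularConj hP, ← rightRegularOp_eq_modularConj]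

/-- This is `E(u_w y) = E(u_w) y` for `y ∈ P`, read off at the coefficient `γ` and extended from `y
δ_e` to the closure by continuity. -/
theorem cyclicProj_leftRegularOp_apply {P : VonNeumannAlgebra (EllTwo Γ)}
    (hP : ∀ x ∈ P, x ∈ rightCommutant Γ) (w γ : Γ) {ξ : EllTwo Γ} (hξ : ξ ∈ cyclicSubspace P) :
    cyclicProj P (leftRegularOp w ξ) γ =
      ⟪modularConj Γ (cyclicProj P (deltaVec w)), rightRegularOp γ ξ⟫_ℂ := by
  refine cyclicSubspace_induction (p := fun ξ => cyclicProj P (leftRegularOp w ξ) γ =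
      ⟪modularConj Γ (cyclicProj P (deltaVec w)), rightRegularOp γ ξ⟫_ℂ) ?_ ?_ hξ
  · simp only [← inner_deltaVec_left]
    exact isClosed_eq (by fun_prop) (by fun_prop)
  · intro y hy
    have hyM := hP y hy
    -- Right multiplication by `y` is `J y* J`, which turns right modularity into the left
    -- modularity already available.
    have h1 : leftRegularOp w (y (deltaVec 1)) =
        modularConj Γ (star y (modularConj Γ (deltaVec w))) := by
      have h2 := modularConj_apply_deltaVec_one
        (mul_mem (leftRegularOp_mem_rightCommutant w) hyM)
      rw [star_mul, star_leftRegularOp] at h2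
      simp only [mul_apply_eq_comp, leftRegularOp_deltaVec, mul_one] at h2
      rw [modularConj_deltaVec, ← h2, modularConj_modularConj]
    rw [h1, cyclicProj_modularConj hP, cyclicProj_mul (star_mem hy), cyclicProj_modularConj hP,
      modularConj_apply, ← inner_deltaVec_right, ContinuousLinearMap.star_eq_adjoint,
      ContinuousLinearMap.adjoint_inner_left, apply_deltaVec_of_mem_rightCommutant hyM, inv_inv]

/-- For `ξ` in the closure of `P δ_e`, the projection of `u_w ξ` is the convolution of the
projection of `δ_w` with `ξ`. -/
theorem hasSum_cyclicProj_convolution {P : VonNeumannAlgebra (EllTwo Γ)}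
    (hP : ∀ x ∈ P, x ∈ rightCommutant Γ) (w γ : Γ) {ξ : EllTwo Γ} (hξ : ξ ∈ cyclicSubspace P) :
    HasSum (fun h => cyclicProj P (deltaVec w) h * ξ (h⁻¹ * γ))
      (cyclicProj P (leftRegularOp w ξ) γ) := by
  rw [cyclicProj_leftRegularOp_apply hP w γ hξ]
  have h := lp.hasSum_inner (𝕜 := ℂ) (modularConj Γ (cyclicProj P (deltaVec w)))
    (rightRegularOp γ ξ)
  rw [← (Equiv.inv Γ).hasSum_iff] at h
  refine h.congr_fun fun k => ?_
  simp [mul_comm]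

/-- The competing expansion of the same coefficient, by linearity and continuity of `e_P` only. -/
theorem hasSum_cyclicProj_leftRegularOp (P : VonNeumannAlgebra (EllTwo Γ)) (w γ : Γ)
    (ξ : EllTwo Γ) :
    HasSum (fun k => ξ k * cyclicProj P (deltaVec (w * k)) γ)
      (cyclicProj P (leftRegularOp w ξ) γ) := by
  have h := (hasSum_deltaVec ξ).mapL
    ((innerSL ℂ (deltaVec γ)).comp ((cyclicProj P).comp (leftRegularOp w)))
  simp only [ContinuousLinearMap.comp_apply, map_smul, innerSL_apply_apply, inner_deltaVec_left,
    leftRegularOp_deltaVec, smul_eq_mul] at h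
  exact h

/-! ### Generators and commutation in generated von Neumann algebras -/

theorem subset_generatedVN {H : Type*} [NormedAddCommGroup H] [InnerProductSpace ℂ H]
    [CompleteSpace H] (S : Set (H →L[ℂ] H)) {x : H →L[ℂ] H} (hx : x ∈ S) : x ∈ generatedVN S := by
  change x ∈ StarSubalgebra.centralizer ℂ (StarSubalgebra.centralizer ℂ S : Set (H →L[ℂ] H))
  rw [StarSubalgebra.mem_centralizer_iff]
  intro g hg
  refine ⟨((StarSubalgebra.mem_centralizer_iff ℂ).1 hg x hx).1.symm,
    ((StarSubalgebra.mem_centralizer_iff ℂ).1 (star_mem hg) x hx).1.symm⟩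

theorem commute_of_mem_generatedVN {H : Type*} [NormedAddCommGroup H] [InnerProductSpace ℂ H]
    [CompleteSpace H] {S : Set (H →L[ℂ] H)} {x T : H →L[ℂ] H} (hx : x ∈ generatedVN S)
    (hT : ∀ s ∈ S, s * T = T * s) (hT' : ∀ s ∈ S, star s * T = T * star s) : x * T = T * x := by
  change x ∈ StarSubalgebra.centralizer ℂ (StarSubalgebra.centralizer ℂ S : Set (H →L[ℂ] H)) at hx
  refine ((StarSubalgebra.mem_centralizer_iff ℂ).1 hx T ?_).1.symm
  exact (StarSubalgebra.mem_centralizer_iff ℂ).2 fun s hs => ⟨hT s hs, hT' s hs⟩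

theorem mem_rightCommutant_of_mem_generatedVN {S : Set (EllTwo Γ →L[ℂ] EllTwo Γ)}
    (hS : ∀ s ∈ S, s ∈ rightCommutant Γ) {x : EllTwo Γ →L[ℂ] EllTwo Γ}
    (hx : x ∈ generatedVN S) : x ∈ rightCommutant Γ := by
  have key : ∀ {y : EllTwo Γ →L[ℂ] EllTwo Γ} (γ : Γ), y ∈ rightCommutant Γ →
      y * rightRegularOp γ = rightRegularOp γ * y := fun γ hy =>
    ContinuousLinearMap.ext fun ξ => mem_rightCommutant_iff.1 hy γ ξ
  refine mem_rightCommutant_iff.2 fun γ ξ => ?_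
  exact congrArg (fun T : EllTwo Γ →L[ℂ] EllTwo Γ => T ξ) (commute_of_mem_generatedVN hx
    (fun s hs => key γ (hS s hs)) fun s hs => key γ (star_mem (hS s hs)))

end GroupGeneralities

/-! ### Coordinates in `ℚ² ⋊ SL₂(ℚ)` -/

/-- The element `(v, g)` of `ℚ² ⋊ SL₂(ℚ)`. -/
def aff (v : Fin 2 → ℚ) (g : SL2Q) : AffineSL2Q := ⟨Multiplicative.ofAdd v, g⟩

theorem aff_mul (v w : Fin 2 → ℚ) (g h : SL2Q) :
    aff v g * aff w h = aff (v + g • w) (g * h) := rfl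

theorem aff_zero_one : aff 0 1 = 1 := rfl

theorem exists_eq_aff (γ : AffineSL2Q) : ∃ v g, γ = aff v g :=
  ⟨γ.left.toAdd, γ.right, rfl⟩

theorem aff_inj {v w : Fin 2 → ℚ} {g h : SL2Q} : aff v g = aff w h ↔ v = w ∧ g = h := by
  constructor
  · intro e
    exact ⟨congrArg (fun γ : AffineSL2Q => γ.left.toAdd) e,
      congrArg (fun γ : AffineSL2Q => γ.right) e⟩
  · rintro ⟨rfl, rfl⟩
    rfl

theorem aff_inv (v : Fin 2 → ℚ) (g : SL2Q) : (aff v g)⁻¹ = aff (-(g⁻¹ • v)) g⁻¹ := by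
  rw [inv_eq_iff_mul_eq_one, aff_mul, smul_neg, smul_inv_smul, add_neg_cancel, mul_inv_cancel,
    aff_zero_one]

theorem sl2Q_smul_zero (g : SL2Q) (v : Fin 2 → ℚ) : (g • v) 0 = g 0 0 * v 0 + g 0 1 * v 1 := by
  change (g.1.mulVec v) 0 = _
  simp [Matrix.mulVec, dotProduct, Fin.sum_univ_two]

theorem sl2Q_smul_one (g : SL2Q) (v : Fin 2 → ℚ) : (g • v) 1 = g 1 0 * v 0 + g 1 1 * v 1 := by
  change (g.1.mulVec v) 1 = _
  simp [Matrix.mulVec, dotProduct, Fin.sum_univ_two]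

theorem vec2_ext {v w : Fin 2 → ℚ} (h0 : v 0 = w 0) (h1 : v 1 = w 1) : v = w := by
  ext i
  fin_cases i
  exacts [h0, h1]

theorem sl2Q_neg_smul (g : SL2Q) (v : Fin 2 → ℚ) : (-g) • v = -(g • v) := by
  apply vec2_ext
  · rw [Pi.neg_apply, sl2Q_smul_zero, sl2Q_smul_zero]; simp; ring
  · rw [Pi.neg_apply, sl2Q_smul_one, sl2Q_smul_one]; simp; ring

theorem sl2Q_neg_one_inv : (-1 : SL2Q)⁻¹ = -1 := by
  rw [inv_eq_iff_mul_eq_one]; simp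

theorem uMat_eq (g : SL2Q) : uMat g = leftRegularOp (aff 0 g) := rfl

theorem uMat_apply (g h : SL2Q) (v : Fin 2 → ℚ) (ξ : EllTwo AffineSL2Q) :
    uMat g ξ (aff v h) = ξ (aff (g⁻¹ • v) (g⁻¹ * h)) := by
  rw [uMat_eq, leftRegularOp_apply, aff_inv, aff_mul]
  simp

theorem uMat_deltaVec (g h : SL2Q) (v : Fin 2 → ℚ) :
    uMat g (deltaVec (aff v h)) = deltaVec (aff (g • v) (g * h)) := by
  rw [uMat_eq, leftRegularOp_deltaVec, aff_mul, zero_add]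

theorem uMat_neg_one_apply (h : SL2Q) (v : Fin 2 → ℚ) (ξ : EllTwo AffineSL2Q) :
    uMat (-1) ξ (aff v h) = ξ (aff (-v) (-h)) := by
  rw [uMat_apply, sl2Q_neg_one_inv, sl2Q_neg_smul, one_smul, neg_one_mul]

theorem star_uMat_neg_one : star (uMat (-1)) = uMat (-1) := by
  rw [uMat_eq, star_leftRegularOp, aff_inv, sl2Q_neg_one_inv, smul_zero, neg_zero]

theorem uMat_neg_one_mul_self : uMat (-1) * uMat (-1) = 1 := by
  rw [uMat_eq, leftRegularOp_mul, aff_mul, smul_zero, add_zero, neg_mul_neg, mul_one,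
    aff_zero_one, leftRegularOp_one]

/-- Right translation by `g ∈ SL₂(ℚ)`. -/
theorem rightRegularOp_aff_apply (g h : SL2Q) (v : Fin 2 → ℚ) (ξ : EllTwo AffineSL2Q) :
    rightRegularOp (aff 0 g) ξ (aff v h) = ξ (aff v (h * g)) := by
  rw [rightRegularOp_apply, aff_mul, smul_zero, add_zero]

theorem rightRegularOp_aff_deltaVec (g h : SL2Q) (v : Fin 2 → ℚ) :
    rightRegularOp (aff 0 g) (deltaVec (aff v h)) = deltaVec (aff v (h * g⁻¹)) := by
  rw [rightRegularOp_deltaVec, aff_inv, aff_mul]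
  simp

/-! ### Fourier supports and centrality of `u_{-id}` -/

open Classical in
/-- Multiplication by the function that is `1` on `S` and `-1` off `S`. -/
noncomputable def signOp {Γ : Type*} (S : Set Γ) : EllTwo Γ →L[ℂ] EllTwo Γ :=
  LinearIsometry.toContinuousLinearMap
    { toFun := fun ξ => ⟨fun h => if h ∈ S then ξ h else -ξ h, by
        have hξ := (memℓp_gen_iff (by norm_num)).1 (lp.memℓp ξ)
        refine memℓp_gen (hξ.congr fun h => ?_)
        split_ifs <;> simp⟩
      map_add' := fun ξ η => by
        ext h
        change (if h ∈ S then (ξ + η) h else -(ξ + η) h) =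
          (if h ∈ S then ξ h else -ξ h) + (if h ∈ S then η h else -η h)
        split_ifs <;> simp [add_comm]
      map_smul' := fun c ξ => by
        ext h
        change (if h ∈ S then (c • ξ) h else -(c • ξ) h) = c • (if h ∈ S then ξ h else -ξ h)
        split_ifs <;> simp
      norm_map' := fun ξ => by
        rw [lp.norm_eq_tsum_rpow (by norm_num), lp.norm_eq_tsum_rpow (by norm_num)]
        congr 1
        refine tsum_congr fun h => ?_
        change ‖if h ∈ S then ξ h else -ξ h‖ ^ (2 : ENNReal).toReal = _
        split_ifs <;> simp }

open Classical in
theorem signOp_apply {Γ : Type*} (S : Set Γ) (ξ : EllTwo Γ) (h : Γ) :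
    signOp S ξ h = if h ∈ S then ξ h else -ξ h := rfl

theorem signOp_leftRegularOp {Γ : Type*} [Group Γ] (S : Set Γ) {γ : Γ}
    (hγ : ∀ h, γ⁻¹ * h ∈ S ↔ h ∈ S) : leftRegularOp γ * signOp S = signOp S * leftRegularOp γ := by
  ext ξ h
  change signOp S ξ (γ⁻¹ * h) = signOp S (leftRegularOp γ ξ) h
  simp only [signOp_apply, leftRegularOp_apply]
  by_cases hs : h ∈ S
  · rw [if_pos hs, if_pos ((hγ h).2 hs)]
  · rw [if_neg hs, if_neg (mt (hγ h).1 hs)]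

theorem uVec_mem_rightCommutant (v : Fin 2 → ℚ) : uVec v ∈ rightCommutant AffineSL2Q :=
  leftRegularOp_mem_rightCommutant _

theorem uMat_mem_rightCommutant (g : SL2Q) : uMat g ∈ rightCommutant AffineSL2Q :=
  leftRegularOp_mem_rightCommutant _

theorem LQ2_le_rightCommutant {a : EllTwo AffineSL2Q →L[ℂ] EllTwo AffineSL2Q} (ha : a ∈ LQ2) :
    a ∈ rightCommutant AffineSL2Q :=
  mem_rightCommutant_of_mem_generatedVN
    (by rintro _ ⟨v, rfl⟩; exact uVec_mem_rightCommutant v) ha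

theorem LSL2Q_le_rightCommutant {a : EllTwo AffineSL2Q →L[ℂ] EllTwo AffineSL2Q}
    (ha : a ∈ LSL2Q) : a ∈ rightCommutant AffineSL2Q :=
  mem_rightCommutant_of_mem_generatedVN
    (by rintro _ ⟨v, rfl⟩; exact uMat_mem_rightCommutant v) ha

theorem crossedProduct_le_rightCommutant {a : EllTwo AffineSL2Q →L[ℂ] EllTwo AffineSL2Q}
    (ha : a ∈ crossedProduct) : a ∈ rightCommutant AffineSL2Q := by
  refine mem_rightCommutant_of_mem_generatedVN ?_ ha
  rintro s (hs | ⟨g, rfl⟩)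
  exacts [LQ2_le_rightCommutant hs.1, uMat_mem_rightCommutant g]

theorem uMat_mem_LSL2Q (g : SL2Q) : uMat g ∈ LSL2Q := subset_generatedVN _ ⟨g, rfl⟩

theorem uMat_mem_crossedProduct (g : SL2Q) : uMat g ∈ crossedProduct :=
  subset_generatedVN _ (Or.inr ⟨g, rfl⟩)

/-- The Fourier expansion of an element of `L(ℚ²)` is supported on `ℚ²`. -/
theorem coeff_eq_zero_of_mem_LQ2 {a : EllTwo AffineSL2Q →L[ℂ] EllTwo AffineSL2Q} (ha : a ∈ LQ2)
    (v : Fin 2 → ℚ) {g : SL2Q} (hg : g ≠ 1) : a (deltaVec 1) (aff v g) = 0 := by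
  -- Left translation by `ℚ²` preserves the `G`-component, so the sign operator of `S` commutes with
  -- `L(ℚ²)`. It fixes `δ_e`, hence fixes `a δ_e`, whose coefficients off `S` then equal their own
  -- negatives.
  set S : Set AffineSL2Q := {γ | γ.right = 1} with hS
  have h1 : a * signOp S = signOp S * a := by
    refine commute_of_mem_generatedVN ha ?_ ?_
    · rintro _ ⟨w, rfl⟩
      refine signOp_leftRegularOp S fun h => ?_
      simp [hS, translation]
    · rintro _ ⟨w, rfl⟩
      rw [uVec, star_leftRegularOp]
      refine signOp_leftRegularOp S fun h => ?_
      simp [hS, translation]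
  have h2 : signOp S (deltaVec 1) = deltaVec 1 := by
    classical
    ext γ
    rw [signOp_apply]
    split_ifs with h
    · rfl
    · rw [deltaVec_of_ne, neg_zero]
      rintro rfl
      exact h rfl
  have h3 := congrArg (fun T : EllTwo AffineSL2Q →L[ℂ] EllTwo AffineSL2Q =>
    T (deltaVec 1) (aff v g)) h1
  change a (signOp S (deltaVec 1)) (aff v g) = signOp S (a (deltaVec 1)) (aff v g) at h3
  have hgS : aff v g ∉ S := hg
  rw [h2, signOp_apply, if_neg hgS] at h3
  exact self_eq_neg.1 h3

/-- Conjugation by `u_{-id}` sends `u_v` to `u_{-v}`, so the symmetry `c_v = c_{-v}` is exactly what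
is needed. -/
theorem symmetricPart_commute {a : EllTwo AffineSL2Q →L[ℂ] EllTwo AffineSL2Q}
    (ha : a ∈ symmetricPart) : a * uMat (-1) = uMat (-1) * a := by
  have haM := LQ2_le_rightCommutant ha.1
  refine rightCommutant_ext (mul_mem haM (uMat_mem_rightCommutant _))
    (mul_mem (uMat_mem_rightCommutant _) haM) ?_
  ext γ
  obtain ⟨v, g, rfl⟩ := exists_eq_aff γ
  change a (uMat (-1) (deltaVec 1)) (aff v g) = uMat (-1) (a (deltaVec 1)) (aff v g)
  rw [uMat_neg_one_apply, ← aff_zero_one, uMat_deltaVec,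
    apply_deltaVec_apply_of_mem_rightCommutant haM, aff_inv, aff_mul, aff_zero_one]
  simp only [mul_one, sl2Q_neg_one_inv, smul_zero, neg_zero, add_zero, mul_neg]
  by_cases hg : -g = 1
  · rw [hg]
    exact ha.2 v
  · rw [coeff_eq_zero_of_mem_LQ2 ha.1 _ hg, coeff_eq_zero_of_mem_LQ2 ha.1 _ hg]

theorem crossedProduct_commute {x : EllTwo AffineSL2Q →L[ℂ] EllTwo AffineSL2Q}
    (hx : x ∈ crossedProduct) : x * uMat (-1) = uMat (-1) * x := by
  refine commute_of_mem_generatedVN hx ?_ ?_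
  · rintro s (hs | ⟨g, rfl⟩)
    · exact symmetricPart_commute hs
    · rw [uMat_eq, uMat_eq, leftRegularOp_mul, leftRegularOp_mul, aff_mul, aff_mul]
      simp
  · rintro s (hs | ⟨g, rfl⟩)
    · have h := congrArg star (symmetricPart_commute hs)
      rw [star_mul, star_mul, star_uMat_neg_one] at h
      exact h.symm
    · rw [uMat_eq, uMat_eq, star_leftRegularOp, leftRegularOp_mul, leftRegularOp_mul, aff_inv,
        aff_mul, aff_mul]
      simp

/-! ### The two central corners -/

/-- The central projection `(1 + σ u_{-id}) / 2` for a sign `σ`. -/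
noncomputable def signProj (σ : ℂ) : EllTwo AffineSL2Q →L[ℂ] EllTwo AffineSL2Q :=
  (1 / 2 : ℂ) • (1 + σ • uMat (-1))

theorem uMat_one : uMat 1 = 1 := leftRegularOp_one

theorem qProj_eq_signProj : qProj = signProj 1 := by
  rw [qProj, signProj, uMat_one, one_smul]

theorem one_sub_qProj_eq_signProj : 1 - qProj = signProj (-1) := by
  rw [qProj, signProj, uMat_one]
  module

theorem signProj_mem {P : VonNeumannAlgebra (EllTwo AffineSL2Q)} (hP : LSL2Q ≤ P) (σ : ℂ) :
    signProj σ ∈ P :=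
  P.toStarSubalgebra.smul_mem (add_mem (one_mem _)
    (P.toStarSubalgebra.smul_mem (hP (uMat_mem_LSL2Q _)) _)) _

theorem LSL2Q_le_crossedProduct : LSL2Q ≤ crossedProduct := fun x hx => by
  have : StarSubalgebra.centralizer ℂ (StarSubalgebra.centralizer ℂ (Set.range uMat) :
      Set (EllTwo AffineSL2Q →L[ℂ] EllTwo AffineSL2Q)) ≤
      StarSubalgebra.centralizer ℂ (StarSubalgebra.centralizer ℂ (symmetricPart ∪ Set.range uMat) :
      Set (EllTwo AffineSL2Q →L[ℂ] EllTwo AffineSL2Q)) :=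
    StarSubalgebra.centralizer_le _ _ _
      (StarSubalgebra.centralizer_le _ _ _ Set.subset_union_right)
  exact this hx

theorem signProj_commute {x : EllTwo AffineSL2Q →L[ℂ] EllTwo AffineSL2Q}
    (hx : x ∈ crossedProduct) (σ : ℂ) : signProj σ * x = x * signProj σ := by
  simp only [signProj, smul_mul_assoc, mul_smul_comm, add_mul, mul_add, one_mul, mul_one,
    crossedProduct_commute hx]

theorem signProj_mul_self {σ : ℂ} (hσ : σ * σ = 1) : signProj σ * signProj σ = signProj σ := by
  have h : (σ • uMat (-1)) * (σ • uMat (-1)) = 1 := by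
    rw [smul_mul_smul_comm, hσ, uMat_neg_one_mul_self, one_smul]
  simp only [signProj, smul_mul_assoc, mul_smul_comm (1 / 2 : ℂ), add_mul, mul_add, one_mul,
    mul_one, h]
  module

theorem isStarProjection_qProj : IsStarProjection qProj := by
  rw [qProj_eq_signProj]
  refine ⟨signProj_mul_self (by norm_num), ?_⟩
  simp [IsSelfAdjoint, signProj, star_uMat_neg_one]

/-! ### Matrix entries, unipotents and transitivity for `SL₂(ℚ)` -/

theorem sl2Q_mul_apply (g h : SL2Q) (i j : Fin 2) :
    (g * h) i j = g i 0 * h 0 j + g i 1 * h 1 j := by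
  simp [Matrix.mul_apply, Fin.sum_univ_two]

theorem sl2Q_det (g : SL2Q) : g 0 0 * g 1 1 - g 0 1 * g 1 0 = 1 := by
  rw [← Matrix.det_fin_two]
  exact g.2

theorem sl2Q_ext {g h : SL2Q} (h00 : g 0 0 = h 0 0) (h01 : g 0 1 = h 0 1)
    (h10 : g 1 0 = h 1 0) (h11 : g 1 1 = h 1 1) : g = h := by
  ext i j
  fin_cases i <;> fin_cases j
  exacts [h00, h01, h10, h11]

theorem sl2Q_inv_apply (g : SL2Q) :
    g⁻¹ 0 0 = g 1 1 ∧ g⁻¹ 0 1 = -g 0 1 ∧ g⁻¹ 1 0 = -g 1 0 ∧ g⁻¹ 1 1 = g 0 0 := by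
  simp [Matrix.adjugate_fin_two]

theorem sl2Q_neg_apply (g : SL2Q) (i j : Fin 2) : (-g) i j = -g i j := by simp

theorem sl2Q_one_apply :
    (1 : SL2Q) 0 0 = 1 ∧ (1 : SL2Q) 0 1 = 0 ∧ (1 : SL2Q) 1 0 = 0 ∧ (1 : SL2Q) 1 1 = 1 := by
  simp

/-- The upper unitriangular matrix with entry `s`. -/
def upperUnip (s : ℚ) : SL2Q := ⟨!![1, s; 0, 1], by simp [Matrix.det_fin_two]⟩

/-- The lower unitriangular matrix with entry `y`. -/
def lowerUnip (y : ℚ) : SL2Q := ⟨!![1, 0; y, 1], by simp [Matrix.det_fin_two]⟩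

theorem upperUnip_apply (s : ℚ) : upperUnip s 0 0 = 1 ∧ upperUnip s 0 1 = s ∧
    upperUnip s 1 0 = 0 ∧ upperUnip s 1 1 = 1 := ⟨rfl, rfl, rfl, rfl⟩

theorem lowerUnip_apply (y : ℚ) : lowerUnip y 0 0 = 1 ∧ lowerUnip y 0 1 = 0 ∧
    lowerUnip y 1 0 = y ∧ lowerUnip y 1 1 = 1 := ⟨rfl, rfl, rfl, rfl⟩

theorem upperUnip_zero : upperUnip 0 = 1 := by
  obtain ⟨a, b, c, d⟩ := upperUnip_apply 0
  obtain ⟨a', b', c', d'⟩ := sl2Q_one_apply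
  apply sl2Q_ext <;> simp_all

theorem lowerUnip_zero : lowerUnip 0 = 1 := by
  obtain ⟨a, b, c, d⟩ := lowerUnip_apply 0
  obtain ⟨a', b', c', d'⟩ := sl2Q_one_apply
  apply sl2Q_ext <;> simp_all

/-- `SL₂(ℚ)` acts transitively on the nonzero vectors. -/
theorem exists_smul_eq {v : Fin 2 → ℚ} (hv : v ≠ 0) : ∃ g : SL2Q, g • ![1, 0] = v := by
  by_cases h0 : v 0 = 0
  · have h1 : v 1 ≠ 0 := fun h1 => hv (vec2_ext h0 h1)
    refine ⟨⟨!![0, -(v 1)⁻¹; v 1, 0], by simp [Matrix.det_fin_two, h1]⟩, vec2_ext ?_ ?_⟩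
    · exact (sl2Q_smul_zero _ _).trans (by simp [h0])
    · exact (sl2Q_smul_one _ _).trans (by simp)
  · refine ⟨⟨!![v 0, 0; v 1, (v 0)⁻¹], by simp [Matrix.det_fin_two, h0]⟩, vec2_ext ?_ ?_⟩
    · exact (sl2Q_smul_zero _ _).trans (by simp)
    · exact (sl2Q_smul_one _ _).trans (by simp)

/-! ### Covariance and support of `e_P δ_v` -/

/-- The projection of `δ_v`, `v ∈ ℚ²`, onto the closure of `P δ_e`. -/
noncomputable def projVec (P : VonNeumannAlgebra (EllTwo AffineSL2Q)) (v : Fin 2 → ℚ) :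
    EllTwo AffineSL2Q :=
  cyclicProj P (deltaVec (aff v 1))

section Intermediate

variable {P : VonNeumannAlgebra (EllTwo AffineSL2Q)}

theorem mem_rightCommutant_of_le (hP' : P ≤ crossedProduct) :
    ∀ x ∈ P, x ∈ rightCommutant AffineSL2Q :=
  fun _ hx => crossedProduct_le_rightCommutant (hP' hx)

theorem cyclicProj_uMat (hP : LSL2Q ≤ P) (g : SL2Q) (ξ : EllTwo AffineSL2Q) :
    cyclicProj P (uMat g ξ) = uMat g (cyclicProj P ξ) :=
  cyclicProj_mul (hP (uMat_mem_LSL2Q g)) ξ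

theorem cyclicProj_right (hP : LSL2Q ≤ P) (hP' : P ≤ crossedProduct) (g : SL2Q)
    (ξ : EllTwo AffineSL2Q) : cyclicProj P (rightRegularOp (aff 0 g) ξ) =
      rightRegularOp (aff 0 g) (cyclicProj P ξ) :=
  cyclicProj_rightRegularOp (mem_rightCommutant_of_le hP') (hP (uMat_mem_LSL2Q g)) ξ

theorem cyclicProj_deltaVec (hP : LSL2Q ≤ P) (hP' : P ≤ crossedProduct) (v : Fin 2 → ℚ)
    (g : SL2Q) :
    cyclicProj P (deltaVec (aff v g)) = rightRegularOp (aff 0 g⁻¹) (projVec P v) := by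
  rw [projVec, ← cyclicProj_right hP hP', rightRegularOp_aff_deltaVec, inv_inv, one_mul]

theorem projVec_smul (hP : LSL2Q ≤ P) (hP' : P ≤ crossedProduct) (v : Fin 2 → ℚ) (g : SL2Q) :
    projVec P (g • v) = uMat g (rightRegularOp (aff 0 g) (projVec P v)) := by
  rw [projVec, projVec, ← cyclicProj_right hP hP', ← cyclicProj_uMat hP,
    rightRegularOp_aff_deltaVec, uMat_deltaVec, one_mul, mul_inv_cancel]

theorem projVec_smul_apply (hP : LSL2Q ≤ P) (hP' : P ≤ crossedProduct) (v w : Fin 2 → ℚ)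
    (g h : SL2Q) :
    projVec P (g • v) (aff (g • w) (g * h * g⁻¹)) = projVec P v (aff w h) := by
  rw [projVec_smul hP hP', uMat_apply, rightRegularOp_aff_apply]
  rw [inv_smul_smul]
  group

/-- Elements of `P` commute with `u_{-id}`, so `x δ_e` is invariant under conjugation by `-id`;
invariance is a closed condition. -/
theorem cyclicSubspace_even (hP' : P ≤ crossedProduct) {ξ : EllTwo AffineSL2Q}
    (hξ : ξ ∈ cyclicSubspace P) :
    uMat (-1) (rightRegularOp (aff 0 (-1)) ξ) = ξ := by
  refine cyclicSubspace_induction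
    (p := fun ξ => uMat (-1) (rightRegularOp (aff 0 (-1)) ξ) = ξ) ?_ ?_ hξ
  · exact isClosed_eq (by fun_prop) continuous_id
  · intro x hx
    have h := congrArg (fun T : EllTwo AffineSL2Q →L[ℂ] EllTwo AffineSL2Q =>
      T (rightRegularOp (aff 0 (-1)) (deltaVec 1))) (crossedProduct_commute (hP' hx))
    change x (uMat (-1) (rightRegularOp (aff 0 (-1)) (deltaVec 1))) =
      uMat (-1) (x (rightRegularOp (aff 0 (-1)) (deltaVec 1))) at h
    rw [mem_rightCommutant_iff.1 (mem_rightCommutant_of_le hP' x hx)] at h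
    rw [← h, ← aff_zero_one, rightRegularOp_aff_deltaVec, uMat_deltaVec, sl2Q_neg_one_inv]
    simp

theorem cyclicSubspace_neg_apply (hP' : P ≤ crossedProduct) {ξ : EllTwo AffineSL2Q}
    (hξ : ξ ∈ cyclicSubspace P) (w : Fin 2 → ℚ) (h : SL2Q) :
    ξ (aff (-w) h) = ξ (aff w h) := by
  conv_rhs => rw [← cyclicSubspace_even hP' hξ, uMat_neg_one_apply, rightRegularOp_aff_apply]
  simp

theorem projVec_mem (v : Fin 2 → ℚ) : projVec P v ∈ cyclicSubspace P := cyclicProj_mem P _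

theorem projVec_neg (hP : LSL2Q ≤ P) (hP' : P ≤ crossedProduct) (v : Fin 2 → ℚ) :
    projVec P (-v) = projVec P v := by
  have h := projVec_smul hP hP' v (-1)
  rwa [cyclicSubspace_even hP' (projVec_mem v), sl2Q_neg_smul, one_smul] at h

/-- Since `δ_h` for `h ∈ G` is fixed by `e_P`, this coefficient is `⟨δ_h, δ_v⟩`. -/
theorem projVec_apply_zero (hP : LSL2Q ≤ P) {v : Fin 2 → ℚ} (hv : v ≠ 0) (h : SL2Q) :
    projVec P v (aff 0 h) = 0 := by
  have h1 : deltaVec (aff 0 h) ∈ cyclicSubspace P := by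
    have h2 := apply_mem_cyclicSubspace (hP (uMat_mem_LSL2Q h))
    rwa [← aff_zero_one, uMat_deltaVec, smul_zero, mul_one] at h2
  rw [projVec, ← inner_deltaVec_left, ← inner_cyclicProj_left, cyclicProj_eq_self h1,
    inner_deltaVec_left, deltaVec_of_ne]
  rw [Ne, aff_inj]
  exact fun h => hv h.1.symm

/-- The upper unipotents fix `e₁`, so coefficients are constant along their conjugation orbits; a
nonzero coefficient cannot lie on an infinite orbit. -/
theorem projVec_support_basis (hP : LSL2Q ≤ P) (hP' : P ≤ crossedProduct) {w : Fin 2 → ℚ}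
    {h : SL2Q} (hne : projVec P ![1, 0] (aff w h) ≠ 0) :
    w 1 = 0 ∧ h 1 0 = 0 ∧ h 0 0 = h 1 1 := by
  have inv : ∀ n : ℕ, projVec P ![1, 0] (aff (upperUnip n • w)
      (upperUnip n * h * (upperUnip n)⁻¹)) = projVec P ![1, 0] (aff w h) := fun n => by
    have h1 : upperUnip n • (![1, 0] : Fin 2 → ℚ) = ![1, 0] := by
      obtain ⟨a, b, c, d⟩ := upperUnip_apply n
      apply vec2_ext
      · rw [sl2Q_smul_zero, a, b]; simp
      · rw [sl2Q_smul_one, c, d]; simp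
    have h2 := projVec_smul_apply hP hP' ![1, 0] w (upperUnip n) h
    rwa [h1] at h2
  by_contra hcon
  refine hne (coeff_eq_zero_of_injective (f := fun n : ℕ => aff (upperUnip n • w)
      (upperUnip n * h * (upperUnip n)⁻¹)) ?_ inv)
  intro m n hmn
  obtain ⟨e1, e2⟩ := aff_inj.1 hmn
  have e3 := congrFun e1 0
  have e4 := congrArg (fun g : SL2Q => g 0 0) e2
  have e5 := congrArg (fun g : SL2Q => g 0 1) e2
  obtain ⟨a, b, c, d⟩ := upperUnip_apply m
  obtain ⟨a', b', c', d'⟩ := upperUnip_apply n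
  obtain ⟨i, j, k, l⟩ := sl2Q_inv_apply (upperUnip m)
  obtain ⟨i', j', k', l'⟩ := sl2Q_inv_apply (upperUnip n)
  simp only [sl2Q_smul_zero, sl2Q_mul_apply, a, b, c, d, a', b', c', d', i, j, k, l, i', j', k',
    l'] at e3 e4 e5
  -- If one of the three conditions fails, the orbit point determines `n`: through the first
  -- coordinate of the vector, the `(0,0)` entry, or, once `h 1 0 = 0`, the `(0,1)` entry.
  have key : (m : ℚ) = n := by
    by_cases hw : w 1 = 0
    · by_cases hh : h 1 0 = 0
      · have h3 : h 1 1 - h 0 0 ≠ 0 := fun h3 => hcon ⟨hw, hh, by linarith⟩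
        apply mul_right_cancel₀ h3
        rw [hh] at e5
        linarith
      · apply mul_right_cancel₀ hh
        linarith
    · apply mul_right_cancel₀ hw
      linarith
  exact_mod_cast key

theorem projVec_support (hP : LSL2Q ≤ P) (hP' : P ≤ crossedProduct) {v w : Fin 2 → ℚ}
    (hv : v ≠ 0) {h : SL2Q} (hne : projVec P v (aff w h) ≠ 0) :
    (∃ t : ℚ, w = t • v) ∧ (h • v = v ∨ h • v = -v) := by
  obtain ⟨g, rfl⟩ := exists_smul_eq hv
  have h1 := projVec_smul_apply hP hP' ![1, 0] (g⁻¹ • w) g (g⁻¹ * h * g)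
  have h2 : g * (g⁻¹ * h * g) * g⁻¹ = h := by group
  rw [smul_inv_smul, h2] at h1
  rw [h1] at hne
  obtain ⟨hw, h10, h00⟩ := projVec_support_basis hP hP' hne
  set k := g⁻¹ * h * g with hk
  have hhk : h * g = g * k := by rw [hk]; group
  constructor
  · refine ⟨(g⁻¹ • w) 0, ?_⟩
    have : g⁻¹ • w = (g⁻¹ • w) 0 • ![1, 0] := vec2_ext (by simp) (by simp [hw])
    conv_lhs => rw [← smul_inv_smul g w, this]
    rw [smul_comm]
  · have hdet := sl2Q_det k
    rw [h10, ← h00, mul_zero, sub_zero, mul_self_eq_one_iff] at hdet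
    rw [← mul_smul, hhk, mul_smul, ← smul_neg]
    refine hdet.imp (fun h3 => ?_) (fun h3 => ?_)
    · congr 1
      apply vec2_ext
      · rw [sl2Q_smul_zero, h3]; simp
      · rw [sl2Q_smul_one, h10]; simp
    · congr 1
      apply vec2_ext
      · rw [sl2Q_smul_zero, h3]; simp
      · rw [sl2Q_smul_one, h10]; simp

/-! ### The component of `e_P δ_v` in a corner -/

/-- The vector `(1 + σ u_{-id}) e_P δ_v`. -/
noncomputable def signVec (P : VonNeumannAlgebra (EllTwo AffineSL2Q)) (σ : ℂ)
    (v : Fin 2 → ℚ) : EllTwo AffineSL2Q :=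
  projVec P v + σ • uMat (-1) (projVec P v)

theorem signVec_mem (hP : LSL2Q ≤ P) (σ : ℂ) (v : Fin 2 → ℚ) :
    signVec P σ v ∈ cyclicSubspace P :=
  add_mem (projVec_mem v) (Submodule.smul_mem _ _
    (mul_mem_cyclicSubspace (hP (uMat_mem_LSL2Q _)) (projVec_mem v)))

theorem signVec_apply (hP' : P ≤ crossedProduct) (σ : ℂ) (v w : Fin 2 → ℚ)
    (h : SL2Q) : signVec P σ v (aff w h) =
      projVec P v (aff w h) + σ * projVec P v (aff w (-h)) := by
  change projVec P v (aff w h) + σ * uMat (-1) (projVec P v) (aff w h) = _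
  rw [uMat_neg_one_apply, cyclicSubspace_neg_apply hP' (projVec_mem v)]

theorem signVec_neg_right (hP' : P ≤ crossedProduct) {σ : ℂ} (hσ : σ * σ = 1) (v w : Fin 2 → ℚ)
    (h : SL2Q) : signVec P σ v (aff w (-h)) = σ * signVec P σ v (aff w h) := by
  rw [signVec_apply hP', signVec_apply hP', neg_neg]
  linear_combination -(projVec P v (aff w (-h))) * hσ

theorem signVec_neg_left (hP : LSL2Q ≤ P) (hP' : P ≤ crossedProduct) (σ : ℂ) (v w : Fin 2 → ℚ)
    (h : SL2Q) : signVec P σ v (aff (-w) h) = signVec P σ v (aff w h) :=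
  cyclicSubspace_neg_apply hP' (signVec_mem hP σ v) w h

theorem signVec_smul_apply (hP : LSL2Q ≤ P) (hP' : P ≤ crossedProduct) (σ : ℂ)
    (v w : Fin 2 → ℚ) (g h : SL2Q) :
    signVec P σ (g • v) (aff (g • w) (g * h * g⁻¹)) = signVec P σ v (aff w h) := by
  have : -(g * h * g⁻¹) = g * -h * g⁻¹ := by simp
  rw [signVec_apply hP', signVec_apply hP', this, projVec_smul_apply hP hP',
    projVec_smul_apply hP hP']

theorem signVec_support (hP : LSL2Q ≤ P) (hP' : P ≤ crossedProduct) {σ : ℂ} {v w : Fin 2 → ℚ}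
    (hv : v ≠ 0) {h : SL2Q} (hne : signVec P σ v (aff w h) ≠ 0) :
    (∃ t : ℚ, t ≠ 0 ∧ w = t • v) ∧ (h • v = v ∨ h • v = -v) := by
  have key : (∃ t : ℚ, w = t • v) ∧ (h • v = v ∨ h • v = -v) := by
    rw [signVec_apply hP'] at hne
    by_cases h1 : projVec P v (aff w h) = 0
    · have h2 : projVec P v (aff w (-h)) ≠ 0 := fun h2 => hne (by simp [h1, h2])
      obtain ⟨h3, h4⟩ := projVec_support hP hP' hv h2
      rw [sl2Q_neg_smul, neg_inj, neg_eq_iff_eq_neg] at h4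
      exact ⟨h3, h4.symm⟩
    · exact projVec_support hP hP' hv h1
  obtain ⟨⟨t, rfl⟩, h2⟩ := key
  refine ⟨⟨t, ?_, rfl⟩, h2⟩
  rintro rfl
  rw [zero_smul, signVec_apply hP', projVec_apply_zero hP hv, projVec_apply_zero hP hv] at hne
  simp at hne

theorem hasSum_signVec_left (hP : LSL2Q ≤ P) (hP' : P ≤ crossedProduct) (σ : ℂ)
    (w v : Fin 2 → ℚ) (γ : AffineSL2Q) :
    HasSum (fun h => projVec P w h * signVec P σ v (h⁻¹ * γ))
      (cyclicProj P (uVec w (signVec P σ v)) γ) :=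
  hasSum_cyclicProj_convolution (mem_rightCommutant_of_le hP') _ _ (signVec_mem hP σ v)

theorem hasSum_signVec_right (P : VonNeumannAlgebra (EllTwo AffineSL2Q)) (σ : ℂ)
    (w v : Fin 2 → ℚ) (γ : AffineSL2Q) :
    HasSum (fun k => signVec P σ v k * cyclicProj P (deltaVec (aff w 1 * k)) γ)
      (cyclicProj P (uVec w (signVec P σ v)) γ) :=
  hasSum_cyclicProj_leftRegularOp P _ _ _

theorem cyclicProj_deltaVec_apply (hP : LSL2Q ≤ P) (hP' : P ≤ crossedProduct)
    (w u x : Fin 2 → ℚ) (m g : SL2Q) :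
    cyclicProj P (deltaVec (aff w 1 * aff u m)) (aff x g) =
      projVec P (w + u) (aff x (g * m⁻¹)) := by
  rw [aff_mul, one_smul, one_mul, cyclicProj_deltaVec hP hP', rightRegularOp_aff_apply]

theorem basis_one_ne_zero : (![1, 0] : Fin 2 → ℚ) ≠ 0 := fun h => by simpa using congrFun h 0

theorem basis_two_ne_zero : (![0, 1] : Fin 2 → ℚ) ≠ 0 := fun h => by simpa using congrFun h 1

theorem fixes_basis_one {h : SL2Q}
    (hh : h • (![1, 0] : Fin 2 → ℚ) = ![1, 0] ∨ h • (![1, 0] : Fin 2 → ℚ) = -![1, 0]) :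
    h 1 0 = 0 ∧ h 0 0 = h 1 1 ∧ (h 0 0 = 1 ∨ h 0 0 = -1) := by
  have key : h 1 0 = 0 ∧ (h 0 0 = 1 ∨ h 0 0 = -1) := by
    rcases hh with hh | hh
    all_goals
      have e0 := congrFun hh 0
      have e1 := congrFun hh 1
      simp [sl2Q_smul_zero, sl2Q_smul_one] at e0 e1
      simp [e0, e1]
  obtain ⟨h1, h2⟩ := key
  have hdet := sl2Q_det h
  refine ⟨h1, ?_, h2⟩
  rcases h2 with h2 | h2 <;> rw [h1, h2] at hdet <;> linarith

theorem fixes_basis_two {h : SL2Q}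
    (hh : h • (![0, 1] : Fin 2 → ℚ) = ![0, 1] ∨ h • (![0, 1] : Fin 2 → ℚ) = -![0, 1]) :
    h 0 1 = 0 ∧ h 0 0 = h 1 1 ∧ (h 0 0 = 1 ∨ h 0 0 = -1) := by
  have key : h 0 1 = 0 ∧ (h 1 1 = 1 ∨ h 1 1 = -1) := by
    rcases hh with hh | hh
    all_goals
      have e0 := congrFun hh 0
      have e1 := congrFun hh 1
      simp [sl2Q_smul_zero, sl2Q_smul_one] at e0 e1
      simp [e0, e1]
  obtain ⟨h1, h2⟩ := key
  have hdet := sl2Q_det h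
  have h3 : h 0 0 = h 1 1 := by
    rcases h2 with h2 | h2 <;> rw [h1, h2] at hdet <;> linarith
  exact ⟨h1, h3, h3 ▸ h2⟩

theorem lowerUnip_neg_ne (y : ℚ) : lowerUnip y ≠ -lowerUnip y := fun h => by
  have := congrArg (fun g : SL2Q => g 0 0) h
  simp only [sl2Q_neg_apply, (lowerUnip_apply y).1] at this
  norm_num at this

/-! ### Two computations of the same coefficients -/

/-- In the convolution, the first factor lives on multiples of `e₂` and signed lower unipotents, the
second on multiples of `e₁` and signed upper unipotents. Such a factorization is unique up to moving
`-id` across, so two terms survive and combine into the product of sign components. -/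
theorem cyclicProj_uVec_signVec_left (hP : LSL2Q ≤ P) (hP' : P ≤ crossedProduct) {σ : ℂ}
    (hσ : σ * σ = 1) (a b y s : ℚ) :
    cyclicProj P (uVec ![0, 1] (signVec P σ ![1, 0]))
        (aff ![a, b + a * y] (lowerUnip y * upperUnip s)) =
      signVec P σ ![0, 1] (aff ![0, b] (lowerUnip y)) *
        signVec P σ ![1, 0] (aff ![a, 0] (upperUnip s)) := by
  classical
  refine (hasSum_signVec_left hP hP' σ ![0, 1] ![1, 0] _).unique ?_
  obtain ⟨l00, l01, l10, l11⟩ := lowerUnip_apply y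
  obtain ⟨u00, u01, u10, u11⟩ := upperUnip_apply s
  have e1 : (aff ![0, b] (lowerUnip y))⁻¹ * aff ![a, b + a * y] (lowerUnip y * upperUnip s) =
      aff ![a, 0] (upperUnip s) := by
    rw [inv_mul_eq_iff_eq_mul, aff_mul, aff_inj]
    refine ⟨vec2_ext ?_ ?_, rfl⟩
    · rw [Pi.add_apply, sl2Q_smul_zero, l00, l01]; simp
    · rw [Pi.add_apply, sl2Q_smul_one, l10, l11]; simp; ring
  have e2 : (aff ![0, b] (-lowerUnip y))⁻¹ * aff ![a, b + a * y] (lowerUnip y * upperUnip s) =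
      aff (-![a, 0]) (-upperUnip s) := by
    rw [inv_mul_eq_iff_eq_mul, aff_mul, aff_inj, neg_mul_neg, sl2Q_neg_smul, smul_neg, neg_neg]
    refine ⟨vec2_ext ?_ ?_, rfl⟩
    · rw [Pi.add_apply, sl2Q_smul_zero, l00, l01]; simp
    · rw [Pi.add_apply, sl2Q_smul_one, l10, l11]; simp; ring
  have hne : aff ![0, b] (lowerUnip y) ≠ aff ![0, b] (-lowerUnip y) := fun h =>
    lowerUnip_neg_ne y (aff_inj.1 h).2
  have h := hasSum_sum_of_ne_finset_zero (f := fun h => projVec P ![0, 1] h *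
    signVec P σ ![1, 0] (h⁻¹ * aff ![a, b + a * y] (lowerUnip y * upperUnip s)))
    (s := {aff ![0, b] (lowerUnip y), aff ![0, b] (-lowerUnip y)})
    (L := .unconditional _) ?_
  · rw [Finset.sum_pair hne, e1, e2, signVec_neg_left hP hP', signVec_neg_right hP' hσ] at h
    rw [signVec_apply hP' σ ![0, 1]]
    convert h using 1
    ring
  · intro h hh
    by_contra hcon
    obtain ⟨w, l, rfl⟩ := exists_eq_aff h
    obtain ⟨u, m, hum⟩ := exists_eq_aff
      ((aff w l)⁻¹ * aff ![a, b + a * y] (lowerUnip y * upperUnip s))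
    rw [hum] at hcon
    obtain ⟨⟨t, rfl⟩, hl⟩ := projVec_support hP hP' basis_two_ne_zero (left_ne_zero_of_mul hcon)
    obtain ⟨⟨t', -, rfl⟩, hm⟩ := signVec_support hP hP' basis_one_ne_zero
      (right_ne_zero_of_mul hcon)
    obtain ⟨hl1, hl2, hl3⟩ := fixes_basis_two hl
    obtain ⟨hm1, hm2, hm3⟩ := fixes_basis_one hm
    rw [inv_mul_eq_iff_eq_mul, aff_mul, aff_inj] at hum
    obtain ⟨hu, hg⟩ := hum
    have hu0 := congrFun hu 0
    have hu1 := congrFun hu 1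
    have g00 := congrArg (fun g : SL2Q => g 0 0) hg
    have g10 := congrArg (fun g : SL2Q => g 1 0) hg
    simp only [Pi.add_apply, sl2Q_smul_zero, sl2Q_smul_one] at hu0 hu1
    simp [sl2Q_mul_apply, l00, l01, l10, l11, u00, u10, hl1, hm1,
      -Matrix.SpecialLinearGroup.coe_mul] at g00 g10 hu0 hu1
    apply hh
    rw [Finset.mem_insert, Finset.mem_singleton, aff_inj, aff_inj]
    rcases hl3 with hl3 | hl3
    · left
      have m00 : m 0 0 = 1 := by rw [hl3] at g00; linarith
      rw [m00] at g10
      rw [hl3] at hu0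
      refine ⟨vec2_ext (by simp) ?_, sl2Q_ext ?_ ?_ ?_ ?_⟩
      · simp; rw [show l 1 0 = y by linarith] at hu1; linear_combination -hu1 + y * hu0
      · rw [l00, hl3]
      · rw [l01, hl1]
      · rw [l10, g10]; ring
      · rw [l11, ← hl2, hl3]
    · right
      have m00 : m 0 0 = -1 := by rw [hl3] at g00; linarith
      rw [m00] at g10
      rw [hl3] at hu0
      refine ⟨vec2_ext (by simp) ?_, sl2Q_ext ?_ ?_ ?_ ?_⟩
      · simp; rw [show l 1 0 = -y by linarith] at hu1; linear_combination -hu1 + y * hu0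
      · rw [sl2Q_neg_apply, l00, hl3]
      · rw [sl2Q_neg_apply, l01, hl1, neg_zero]
      · rw [sl2Q_neg_apply, l10, g10]; ring
      · rw [sl2Q_neg_apply, l11, ← hl2, hl3]

/-- Every term of the basis expansion vanishes: a nonzero one, coming from `(t e₁, m)`, needs
`lowerUnip y * upperUnip s * m⁻¹` to fix `(t, 1)` up to sign and `(a, b + a y)` to be proportional
to `(t, 1)`. Together these force `a y = -2 b`. -/
theorem cyclicProj_uVec_signVec_eq_zero (hP : LSL2Q ≤ P) (hP' : P ≤ crossedProduct) {σ : ℂ}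
    {a b y s : ℚ} (hy : y ≠ 0) (hab : a * y ≠ -2 * b) :
    cyclicProj P (uVec ![0, 1] (signVec P σ ![1, 0]))
        (aff ![a, b + a * y] (lowerUnip y * upperUnip s)) = 0 := by
  refine (hasSum_signVec_right P σ ![0, 1] ![1, 0] _).unique ?_
  convert hasSum_zero using 2 with k
  obtain ⟨u, m, rfl⟩ := exists_eq_aff k
  by_contra hcon
  obtain ⟨⟨t, ht, rfl⟩, hm⟩ := signVec_support hP hP' basis_one_ne_zero
    (left_ne_zero_of_mul hcon)
  have h1 := right_ne_zero_of_mul hcon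
  rw [cyclicProj_deltaVec_apply hP hP'] at h1
  have hne : (![0, 1] : Fin 2 → ℚ) + t • ![1, 0] ≠ 0 := fun h => by simpa using congrFun h 1
  obtain ⟨⟨r, hr⟩, hfix⟩ := projVec_support hP hP' hne h1
  obtain ⟨hm1, hm2, hm3⟩ := fixes_basis_one hm
  obtain ⟨l00, l01, l10, l11⟩ := lowerUnip_apply y
  obtain ⟨u00, u01, u10, u11⟩ := upperUnip_apply s
  obtain ⟨i00, i01, i10, i11⟩ := sl2Q_inv_apply m
  have hr0 := congrFun hr 0
  have hr1 := congrFun hr 1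
  simp at hr0 hr1
  -- Up to a sign the matrix is lower unipotent times upper unipotent. If that product fixes `(t,
  -- 1)`, then `y t = 0`, which is excluded; if it negates it, then `y t = 2`.
  have hty : y * t = 2 := by
    rcases hfix with hfix | hfix
    all_goals
      have f0 := congrFun hfix 0
      have f1 := congrFun hfix 1
      simp [sl2Q_smul_zero, sl2Q_smul_one, sl2Q_mul_apply, l00, l01, l10, l11, u00, u01, u10, u11,
        i00, i01, i10, i11, hm1, ← hm2, -Matrix.SpecialLinearGroup.coe_mul,
        -Matrix.SpecialLinearGroup.coe_inv] at f0 f1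
    · rcases hm3 with hm3 | hm3
      · rw [hm3] at f0 f1
        exact absurd (show y * t = 0 by linear_combination f1 - y * f0) (mul_ne_zero hy ht)
      · rw [hm3] at f0 f1
        linear_combination f1 - y * f0
    · rcases hm3 with hm3 | hm3
      · rw [hm3] at f0 f1
        linear_combination y * f0 - f1
      · rw [hm3] at f0 f1
        exact absurd (show y * t = 0 by linear_combination y * f0 - f1) (mul_ne_zero hy ht)
  apply hab
  rw [← hr1] at hr0
  linear_combination -y * hr0 - (b + a * y) * hty

/-- At the identity matrix the support conditions leave `m = ±id` and `t = a / b`. The two remaining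
terms combine into a sign component at the vector `(a / b, 1)`, which covariance moves back to `e₁`.
-/
theorem cyclicProj_uVec_signVec_diag (hP : LSL2Q ≤ P) (hP' : P ≤ crossedProduct) {σ : ℂ}
    (hσ : σ * σ = 1) {a b : ℚ} (hb : b ≠ 0) :
    cyclicProj P (uVec ![0, 1] (signVec P σ ![1, 0])) (aff ![a, b] 1) =
      signVec P σ ![1, 0] (aff ![a / b, 0] 1) * signVec P σ ![1, 0] (aff ![b, 0] 1) := by
  classical
  refine (hasSum_signVec_right P σ ![0, 1] ![1, 0] _).unique ?_
  have hne : aff ![a / b, 0] 1 ≠ aff ![a / b, 0] (-1) := fun h => by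
    have := congrArg (fun g : SL2Q => g 0 0) (aff_inj.1 h).2
    simp only [sl2Q_neg_apply, sl2Q_one_apply.1] at this
    norm_num at this
  have h := hasSum_sum_of_ne_finset_zero (f := fun k => signVec P σ ![1, 0] k *
    cyclicProj P (deltaVec (aff ![0, 1] 1 * k)) (aff ![a, b] 1))
    (s := {aff ![a / b, 0] 1, aff ![a / b, 0] (-1)}) (L := .unconditional _) ?_
  · rw [Finset.sum_pair hne, cyclicProj_deltaVec_apply hP hP', cyclicProj_deltaVec_apply hP hP',
      signVec_neg_right hP' hσ, inv_one, sl2Q_neg_one_inv, one_mul, one_mul] at h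
    have hv : (![0, 1] : Fin 2 → ℚ) + ![a / b, 0] ≠ 0 := fun h => by simpa using congrFun h 1
    obtain ⟨g, hg⟩ := exists_smul_eq hv
    have hw : ![a, b] = g • (![b, 0] : Fin 2 → ℚ) := by
      have h1 : (![b, 0] : Fin 2 → ℚ) = b • ![1, 0] := vec2_ext (by simp) (by simp)
      rw [h1, smul_comm, hg]
      exact vec2_ext (by simp; field_simp) (by simp)
    have h2 := signVec_smul_apply hP hP' σ ![1, 0] ![b, 0] g 1
    rw [mul_one, mul_inv_cancel, hg, ← hw, signVec_apply hP'] at h2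
    convert h using 1
    rw [← h2]
    ring
  · intro k hk
    by_contra hcon
    obtain ⟨u, m, rfl⟩ := exists_eq_aff k
    obtain ⟨⟨t, ht, rfl⟩, hm⟩ := signVec_support hP hP' basis_one_ne_zero
      (left_ne_zero_of_mul hcon)
    have h1 := right_ne_zero_of_mul hcon
    rw [cyclicProj_deltaVec_apply hP hP'] at h1
    have hne : (![0, 1] : Fin 2 → ℚ) + t • ![1, 0] ≠ 0 := fun h => by simpa using congrFun h 1
    obtain ⟨⟨r, hr⟩, hfix⟩ := projVec_support hP hP' hne h1
    obtain ⟨hm1, hm2, hm3⟩ := fixes_basis_one hm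
    obtain ⟨i00, i01, i10, i11⟩ := sl2Q_inv_apply m
    have hr0 := congrFun hr 0
    have hr1 := congrFun hr 1
    simp at hr0 hr1
    have hm01 : m 0 1 = 0 := by
      rcases hfix with hfix | hfix
      all_goals
        have f0 := congrFun hfix 0
        have f1 := congrFun hfix 1
        simp [sl2Q_smul_zero, sl2Q_smul_one,
          i00, i01, i10, i11, hm1, ← hm2, -Matrix.SpecialLinearGroup.coe_mul,
          -Matrix.SpecialLinearGroup.coe_inv] at f0 f1
        rw [f1] at f0
        linarith
    apply hk
    have ht' : t • (![1, 0] : Fin 2 → ℚ) = ![a / b, 0] := by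
      refine vec2_ext ?_ (by simp)
      simp
      rw [eq_div_iff hb, hr0, hr1, mul_comm]
    rw [Finset.mem_insert, Finset.mem_singleton, aff_inj, aff_inj, ht']
    obtain ⟨o00, o01, o10, o11⟩ := sl2Q_one_apply
    refine hm3.imp (fun h3 => ⟨rfl, ?_⟩) (fun h3 => ⟨rfl, ?_⟩)
    · apply sl2Q_ext
      · rw [h3, o00]
      · rw [hm01, o01]
      · rw [hm1, o10]
      · rw [← hm2, h3, o11]
    · apply sl2Q_ext <;> rw [sl2Q_neg_apply]
      · rw [h3, o00]
      · rw [hm01, o01, neg_zero]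
      · rw [hm1, o10, neg_zero]
      · rw [← hm2, h3, o11]

/-- Covariance under the rotation by a quarter turn, which swaps the two coordinate axes and the two
unipotent groups. -/
theorem signVec_basis_two (hP : LSL2Q ≤ P) (hP' : P ≤ crossedProduct) (σ : ℂ) (t y : ℚ) :
    signVec P σ ![0, 1] (aff ![0, t] (lowerUnip y)) =
      signVec P σ ![1, 0] (aff ![t, 0] (upperUnip (-y))) := by
  let g : SL2Q := ⟨!![0, -1; 1, 0], by simp [Matrix.det_fin_two]⟩
  have g00 : g 0 0 = 0 := rfl
  have g01 : g 0 1 = -1 := rfl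
  have g10 : g 1 0 = 1 := rfl
  have g11 : g 1 1 = 0 := rfl
  have hg : ∀ r : ℚ, g • (![r, 0] : Fin 2 → ℚ) = ![0, r] := fun r =>
    vec2_ext (by simp [sl2Q_smul_zero, g00]) (by simp [sl2Q_smul_one, g10])
  have hgu : g * upperUnip (-y) * g⁻¹ = lowerUnip y := by
    rw [mul_inv_eq_iff_eq_mul]
    obtain ⟨l00, l01, l10, l11⟩ := lowerUnip_apply y
    obtain ⟨u00, u01, u10, u11⟩ := upperUnip_apply (-y)
    apply sl2Q_ext <;> simp only [sl2Q_mul_apply, l00, l01, l10, l11, u00, u01, u10, u11, g00, g01,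
      g10, g11] <;> ring
  have h := signVec_smul_apply hP hP' σ ![1, 0] ![t, 0] g (upperUnip (-y))
  rwa [hg, hg, hgu] at h

theorem signVec_upperUnip_eq_zero (hP : LSL2Q ≤ P) (hP' : P ≤ crossedProduct) {σ : ℂ}
    (hσ : σ * σ = 1) (t : ℚ) {s : ℚ} (hs : s ≠ 0) :
    signVec P σ ![1, 0] (aff ![t, 0] (upperUnip s)) = 0 := by
  by_contra hne
  have ht : t ≠ 0 := by
    obtain ⟨⟨r, hr, h⟩, -⟩ := signVec_support hP hP' basis_one_ne_zero hne
    have h0 := congrFun h 0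
    simp at h0
    rwa [h0]
  have key : ∀ a : ℚ, signVec P σ ![1, 0] (aff ![a, 0] (upperUnip s)) ≠ 0 →
      a * -s = -2 * t := by
    intro a ha
    by_contra hcon
    -- The choice `y = -s` makes the first factor, after rotation, the coefficient at `upperUnip s`
    -- assumed nonzero.
    have h1 := cyclicProj_uVec_signVec_left hP hP' hσ a t (-s) s
    rw [cyclicProj_uVec_signVec_eq_zero hP hP' (neg_ne_zero.2 hs) hcon, signVec_basis_two hP hP',
      neg_neg] at h1
    exact mul_ne_zero hne ha h1.symm
  have h1 := key t hne
  -- Evenness gives a second admissible value of `a`; the linear conditions for `t` and `-t` are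
  -- incompatible unless `t = 0`.
  have h2 := key (-t) (by
    have h3 : (![-t, 0] : Fin 2 → ℚ) = -![t, 0] := vec2_ext (by simp) (by simp)
    rwa [h3, signVec_neg_left hP hP'])
  exact ht (by linarith)

theorem signVec_diag_mul (hP : LSL2Q ≤ P) (hP' : P ≤ crossedProduct) {σ : ℂ}
    (hσ : σ * σ = 1) (a : ℚ) {b : ℚ} (hb : b ≠ 0) :
    signVec P σ ![1, 0] (aff ![b, 0] 1) * signVec P σ ![1, 0] (aff ![a, 0] 1) =
      signVec P σ ![1, 0] (aff ![a / b, 0] 1) * signVec P σ ![1, 0] (aff ![b, 0] 1) := by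
  rw [← cyclicProj_uVec_signVec_diag hP hP' hσ hb]
  have h := cyclicProj_uVec_signVec_left hP hP' hσ a b 0 0
  rw [signVec_basis_two hP hP', neg_zero, upperUnip_zero, lowerUnip_zero, mul_one, mul_zero,
    add_zero] at h
  exact h.symm

/-- Cancelling the nonzero coefficient at `t` in `signVec_diag_mul` makes the coefficients invariant
under division by `t`. All positive powers of `t` then carry the same coefficient, and they are
distinct unless `|t| = 1`. -/
theorem signVec_diag_support (hP : LSL2Q ≤ P) (hP' : P ≤ crossedProduct) {σ : ℂ}
    (hσ : σ * σ = 1) {t : ℚ} (hne : signVec P σ ![1, 0] (aff ![t, 0] 1) ≠ 0) :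
    t = 1 ∨ t = -1 := by
  have ht : t ≠ 0 := by
    obtain ⟨⟨r, hr, h⟩, -⟩ := signVec_support hP hP' basis_one_ne_zero hne
    have h0 := congrFun h 0
    simp at h0
    rwa [h0]
  have hpow : ∀ n : ℕ, signVec P σ ![1, 0] (aff ![t ^ (n + 1), 0] 1) =
      signVec P σ ![1, 0] (aff ![t, 0] 1) := by
    intro n
    induction n with
    | zero => simp
    | succ n ih =>
      rw [← ih]
      apply mul_left_cancel₀ hne
      rw [signVec_diag_mul hP hP' hσ _ ht, mul_comm]
      congr 3
      rw [pow_succ t (n + 1), mul_div_cancel_right₀ _ ht]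
  by_contra hcon
  refine hne (coeff_eq_zero_of_injective (f := fun n : ℕ => aff ![t ^ (n + 1), 0] 1) ?_ hpow)
  intro m n hmn
  have h1 := congrFun (aff_inj.1 hmn).1 0
  have h2 : |t| ^ (m + 1) = |t| ^ (n + 1) := by
    rw [← abs_pow, ← abs_pow]
    exact congrArg abs h1
  have h3 : |t| ≠ 1 := fun h => hcon ((abs_eq zero_le_one).1 h)
  have := pow_right_injective₀ (abs_pos.2 ht) h3 h2
  omega

/-! ### The dichotomy on each corner and its consequences -/

theorem signProj_deltaVec (σ : ℂ) (v : Fin 2 → ℚ) :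
    signProj σ (deltaVec (aff v 1)) =
      (1 / 2 : ℂ) • (deltaVec (aff v 1) + σ • deltaVec (aff (-v) (-1))) := by
  change (1 / 2 : ℂ) • (deltaVec (aff v 1) + σ • uMat (-1) (deltaVec (aff v 1))) = _
  rw [uMat_deltaVec, sl2Q_neg_smul, one_smul, mul_one]

theorem signProj_projVec (σ : ℂ) (v : Fin 2 → ℚ) :
    signProj σ (projVec P v) = (1 / 2 : ℂ) • signVec P σ v := rfl

theorem signVec_basis_one (hP : LSL2Q ≤ P) (hP' : P ≤ crossedProduct) {σ : ℂ}
    (hσ : σ * σ = 1) : signVec P σ ![1, 0] = signVec P σ ![1, 0] (aff ![1, 0] 1) •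
      ((deltaVec (aff ![1, 0] 1) + σ • deltaVec (aff (-![1, 0]) (-1))) +
        (deltaVec (aff (-![1, 0]) 1) + σ • deltaVec (aff (- -![1, 0]) (-1)))) := by
  classical
  have hn1 : (1 : SL2Q) ≠ -1 := fun h => by
    have := congrArg (fun g : SL2Q => g 0 0) h
    simp only [sl2Q_neg_apply, sl2Q_one_apply.1] at this
    norm_num at this
  have hne : (![1, 0] : Fin 2 → ℚ) ≠ -![1, 0] := fun h => by
    have := congrFun h 0
    norm_num at this
  ext γ
  obtain ⟨w, h, rfl⟩ := exists_eq_aff γ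
  simp only [lp.coeFn_add, lp.coeFn_smul, Pi.add_apply, Pi.smul_apply, smul_eq_mul,
    deltaVec_apply, aff_inj, neg_neg]
  by_cases hz : signVec P σ ![1, 0] (aff w h) = 0
  · rw [hz, eq_comm]
    by_cases hh : h = 1 ∨ h = -1
    · by_cases hw : w = ![1, 0] ∨ w = -![1, 0]
      · have : signVec P σ ![1, 0] (aff ![1, 0] 1) = 0 := by
          have h1 : signVec P σ ![1, 0] (aff ![1, 0] h) = 0 := by
            rcases hw with rfl | rfl
            · exact hz
            · rwa [signVec_neg_left hP hP'] at hz
          rcases hh with rfl | rfl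
          · exact h1
          · rw [signVec_neg_right hP' hσ] at h1
            exact (mul_eq_zero.1 h1).resolve_left (left_ne_zero_of_mul_eq_one hσ)
        rw [this, zero_mul]
      · rw [not_or] at hw
        simp [hw.1, hw.2, -Matrix.neg_cons]
    · rw [not_or] at hh
      simp [hh.1, hh.2]
  · obtain ⟨⟨t, ht, rfl⟩, hm⟩ := signVec_support hP hP' basis_one_ne_zero hz
    obtain ⟨hm1, hm2, hm3⟩ := fixes_basis_one hm
    have htv : t • (![1, 0] : Fin 2 → ℚ) = ![t, 0] := vec2_ext (by simp) (by simp)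
    rw [htv] at hz ⊢
    -- The support lemma leaves a signed upper unipotent; the vanishing lemma then forces `s = 0`.
    have hU : ∃ s, h = upperUnip s ∨ h = -upperUnip s := by
      rcases hm3 with hm3 | hm3
      · refine ⟨h 0 1, Or.inl ?_⟩
        obtain ⟨u00, u01, u10, u11⟩ := upperUnip_apply (h 0 1)
        apply sl2Q_ext
        · rw [u00, hm3]
        · rw [u01]
        · rw [u10, hm1]
        · rw [u11, ← hm2, hm3]
      · refine ⟨-h 0 1, Or.inr ?_⟩
        obtain ⟨u00, u01, u10, u11⟩ := upperUnip_apply (-h 0 1)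
        apply sl2Q_ext <;> rw [sl2Q_neg_apply]
        · rw [u00, hm3]
        · rw [u01, neg_neg]
        · rw [u10, hm1, neg_zero]
        · rw [u11, ← hm2, hm3]
    have hh : h = 1 ∨ h = -1 := by
      obtain ⟨s, hs⟩ := hU
      have hs0 : s = 0 := by
        by_contra hs0
        have h0 := signVec_upperUnip_eq_zero hP hP' hσ t hs0
        rcases hs with rfl | rfl
        · exact hz h0
        · rw [signVec_neg_right hP' hσ, h0, mul_zero] at hz
          exact hz rfl
      rwa [hs0, upperUnip_zero] at hs
    have ht1 : signVec P σ ![1, 0] (aff ![t, 0] 1) ≠ 0 := by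
      rcases hh with rfl | rfl
      · exact hz
      · rw [signVec_neg_right hP' hσ] at hz
        exact right_ne_zero_of_mul hz
    have hneg : (![-1, 0] : Fin 2 → ℚ) = -![1, 0] := vec2_ext (by simp) (by simp)
    rcases signVec_diag_support hP hP' hσ ht1 with rfl | rfl <;> rcases hh with rfl | rfl
    · simp [hne, hn1, -Matrix.neg_cons]
    · rw [signVec_neg_right hP' hσ]
      simp [hne, hn1.symm, mul_comm, -Matrix.neg_cons]
    · rw [hneg, signVec_neg_left hP hP']
      simp [hne.symm, hn1, -Matrix.neg_cons]
    · rw [hneg, signVec_neg_left hP hP', signVec_neg_right hP' hσ]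
      simp [hne.symm, hn1.symm, mul_comm, -Matrix.neg_cons]

/-- On each of the two central corners the projection onto the closure of `P δ_e` either kills
`δ_v` for all `v ≠ 0` or symmetrizes it. -/
theorem signProj_projVec_dichotomy (hP : LSL2Q ≤ P) (hP' : P ≤ crossedProduct) {σ : ℂ}
    (hσ : σ * σ = 1) :
    (∀ v, v ≠ 0 → signProj σ (projVec P v) = 0) ∨
    (∀ v, signProj σ (projVec P v) = signProj σ
      ((1 / 2 : ℂ) • (deltaVec (aff v 1) + deltaVec (aff (-v) 1)))) := by
  have hq : ∀ ξ, cyclicProj P (signProj σ ξ) = signProj σ (cyclicProj P ξ) :=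
    cyclicProj_mul (signProj_mem hP σ)
  have hconj : ∀ (g : SL2Q) (ξ : EllTwo AffineSL2Q),
      signProj σ (uMat g (rightRegularOp (aff 0 g) ξ)) =
        uMat g (rightRegularOp (aff 0 g) (signProj σ ξ)) := fun g ξ => by
    have h1 := congrArg (fun T : EllTwo AffineSL2Q →L[ℂ] EllTwo AffineSL2Q =>
      T (rightRegularOp (aff 0 g) ξ)) (signProj_commute (uMat_mem_crossedProduct g) σ)
    change signProj σ (uMat g (rightRegularOp (aff 0 g) ξ)) =
      uMat g (signProj σ (rightRegularOp (aff 0 g) ξ)) at h1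
    rw [h1, mem_rightCommutant_iff.1 (LSL2Q_le_rightCommutant (signProj_mem le_rfl σ))]
  set c := signVec P σ ![1, 0] (aff ![1, 0] 1) with hc
  have h1 : signProj σ (projVec P ![1, 0]) = signProj σ
      (c • (deltaVec (aff ![1, 0] 1) + deltaVec (aff (-![1, 0]) 1))) := by
    rw [signProj_projVec, signVec_basis_one hP hP' hσ, ← hc, map_smul, map_add,
      signProj_deltaVec, signProj_deltaVec]
    module
  -- Apply `e_P` to `h1`: the left side is unchanged, and `δ_v`, `δ_{-v}` have the same projection.
  -- Hence either the vector is zero or `c = 1/2`.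
  have h2 : signProj σ (projVec P ![1, 0]) = (2 * c) • signProj σ (projVec P ![1, 0]) := by
    have h3 := congrArg (cyclicProj P) h1
    rw [hq, hq, map_smul, map_add, cyclicProj_eq_self (projVec_mem _)] at h3
    change _ = signProj σ (c • (projVec P ![1, 0] + projVec P (-![1, 0]))) at h3
    rw [projVec_neg hP hP', map_smul, map_add] at h3
    conv_lhs => rw [h3]
    module
  by_cases h0 : signProj σ (projVec P ![1, 0]) = 0
  · left
    intro v hv
    obtain ⟨g, rfl⟩ := exists_smul_eq hv
    rw [projVec_smul hP hP', hconj, h0, map_zero, map_zero]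
  · right
    have hc2 : c = 1 / 2 := by
      have h3 : (1 - 2 * c) • signProj σ (projVec P ![1, 0]) = 0 := by
        rw [sub_smul, one_smul, ← h2, sub_self]
      have h4 := (smul_eq_zero.1 h3).resolve_right h0
      linear_combination (-1 / 2 : ℂ) * h4
    intro v
    by_cases hv : v = 0
    · subst hv
      have h3 : projVec P 0 = deltaVec (aff 0 1) := by
        rw [projVec, aff_zero_one]
        exact cyclicProj_eq_self (apply_mem_cyclicSubspace (one_mem P))
      rw [h3, neg_zero]
      congr 1
      module
    · obtain ⟨g, rfl⟩ := exists_smul_eq hv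
      rw [projVec_smul hP hP', hconj, h1, hc2, ← hconj]
      congr 1
      rw [map_smul, map_smul, map_add, map_add, rightRegularOp_aff_deltaVec,
        rightRegularOp_aff_deltaVec, uMat_deltaVec, uMat_deltaVec, smul_neg, one_mul,
        mul_inv_cancel]

/-- On this corner `e_P` kills every `δ_{(v,g)}` with `v ≠ 0`, so its range there lies in the
closure of `L(G) δ_e`; membership in `L(G)` follows from `mem_of_apply_mem_cyclicSubspace`. -/
theorem signProj_mul_mem_LSL2Q (hP : LSL2Q ≤ P) (hP' : P ≤ crossedProduct) {σ : ℂ}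
    (h : ∀ v, v ≠ 0 → signProj σ (projVec P v) = 0)
    {x : EllTwo AffineSL2Q →L[ℂ] EllTwo AffineSL2Q} (hx : x ∈ P) :
    signProj σ * x ∈ LSL2Q := by
  have hqM : signProj σ ∈ rightCommutant AffineSL2Q :=
    LSL2Q_le_rightCommutant (signProj_mem le_rfl σ)
  have key : ∀ ξ, signProj σ (cyclicProj P ξ) ∈ cyclicSubspace LSL2Q := by
    intro ξ
    refine mem_of_forall_deltaVec_mem ((cyclicSubspace LSL2Q).comap
      ((signProj σ).comp (cyclicProj P)).toLinearMap) ?_ ?_ ξ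
    · exact (isClosed_cyclicSubspace _).preimage ((signProj σ).comp (cyclicProj P)).continuous
    · intro γ
      obtain ⟨v, g, rfl⟩ := exists_eq_aff γ
      change signProj σ (cyclicProj P (deltaVec (aff v g))) ∈ cyclicSubspace LSL2Q
      by_cases hv : v = 0
      · subst hv
        have h1 := apply_mem_cyclicSubspace (uMat_mem_LSL2Q g)
        rw [← aff_zero_one, uMat_deltaVec, smul_zero, mul_one] at h1
        rw [cyclicProj_eq_self (cyclicSubspace_mono hP h1)]
        exact mul_mem_cyclicSubspace (signProj_mem le_rfl σ) h1
      · rw [cyclicProj_deltaVec hP hP', mem_rightCommutant_iff.1 hqM, h v hv, map_zero]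
        exact zero_mem _
  refine mem_of_apply_mem_cyclicSubspace (fun _ => LSL2Q_le_rightCommutant)
    (mul_mem hqM (mem_rightCommutant_of_le hP' x hx)) ?_
  have := key (x (deltaVec 1))
  rwa [cyclicProj_eq_self (apply_mem_cyclicSubspace hx)] at this

theorem signProj_mul_mem (hP : LSL2Q ≤ P) (hP' : P ≤ crossedProduct) {σ : ℂ}
    (h : ∀ v, signProj σ (projVec P v) = signProj σ
      ((1 / 2 : ℂ) • (deltaVec (aff v 1) + deltaVec (aff (-v) 1))))
    {x : EllTwo AffineSL2Q →L[ℂ] EllTwo AffineSL2Q} (hx : x ∈ crossedProduct) :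
    signProj σ * x ∈ P := by
  have hqM : signProj σ ∈ rightCommutant AffineSL2Q :=
    LSL2Q_le_rightCommutant (signProj_mem le_rfl σ)
  -- On the corner `e_P` is averaging over conjugation by `-id`, which fixes `x δ_e` for every `x ∈
  -- A ⋊ G`.
  have key : (signProj σ).comp (cyclicProj P) = (signProj σ).comp ((1 / 2 : ℂ) •
      (1 + (uMat (-1)).comp (rightRegularOp (aff 0 (-1))))) := by
    refine ellTwo_clm_ext fun γ => ?_
    obtain ⟨v, g, rfl⟩ := exists_eq_aff γ
    change signProj σ (cyclicProj P (deltaVec (aff v g))) = signProj σ ((1 / 2 : ℂ) •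
      (deltaVec (aff v g) + uMat (-1) (rightRegularOp (aff 0 (-1)) (deltaVec (aff v g)))))
    rw [cyclicProj_deltaVec hP hP', mem_rightCommutant_iff.1 hqM, h v,
      ← mem_rightCommutant_iff.1 hqM, map_smul, map_add, rightRegularOp_aff_deltaVec,
      rightRegularOp_aff_deltaVec, rightRegularOp_aff_deltaVec, uMat_deltaVec, sl2Q_neg_one_inv,
      sl2Q_neg_smul, one_smul, inv_inv, one_mul, mul_neg_one, neg_mul_neg, one_mul]
  refine mem_of_apply_mem_cyclicSubspace (mem_rightCommutant_of_le hP')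
    (mul_mem hqM (crossedProduct_le_rightCommutant hx)) ?_
  have h1 := congrArg (fun T : EllTwo AffineSL2Q →L[ℂ] EllTwo AffineSL2Q =>
    T (x (deltaVec 1))) key
  change signProj σ (cyclicProj P (x (deltaVec 1))) = signProj σ ((1 / 2 : ℂ) •
    (x (deltaVec 1) + uMat (-1) (rightRegularOp (aff 0 (-1)) (x (deltaVec 1))))) at h1
  rw [cyclicSubspace_even le_rfl (apply_mem_cyclicSubspace hx)] at h1
  have h2 : (1 / 2 : ℂ) • (x (deltaVec 1) + x (deltaVec 1)) = x (deltaVec 1) := by module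
  rw [h2] at h1
  change signProj σ (x (deltaVec 1)) ∈ cyclicSubspace P
  rw [← h1]
  exact mul_mem_cyclicSubspace (signProj_mem hP σ) (cyclicProj_mem P _)

end Intermediate

/-! ### Assembling the four intermediate algebras -/

theorem mainTheorem4 :
    (IsStarProjection qProj ∧ qProj ∈ crossedProduct ∧
      ∀ x ∈ crossedProduct, qProj * x = x * qProj) ∧
    ∀ P : VonNeumannAlgebra (EllTwo AffineSL2Q), LSL2Q ≤ P → P ≤ crossedProduct →
      (P = LSL2Q ∨ P = crossedProduct ∨
        (P : Set (EllTwo AffineSL2Q →L[ℂ] EllTwo AffineSL2Q)) =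
          cornerSum qProj LSL2Q crossedProduct ∨
        (P : Set (EllTwo AffineSL2Q →L[ℂ] EllTwo AffineSL2Q)) =
          cornerSum qProj crossedProduct LSL2Q) := by
  refine ⟨⟨isStarProjection_qProj, ?_, fun x hx => ?_⟩, fun P hP hP' => ?_⟩
  · rw [qProj_eq_signProj]
    exact signProj_mem LSL2Q_le_crossedProduct 1
  · rw [qProj_eq_signProj]
    exact signProj_commute hx 1
  have hq : qProj * qProj = qProj := isStarProjection_qProj.isIdempotentElem
  have hqq : qProj * (1 - qProj) = 0 := by rw [mul_sub, mul_one, hq, sub_self]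
  have hqq' : (1 - qProj) * qProj = 0 := by rw [sub_mul, one_mul, hq, sub_self]
  have hq' : (1 - qProj) * (1 - qProj) = 1 - qProj := by rw [mul_sub, mul_one, hqq', sub_zero]
  have hqP : qProj ∈ P := qProj_eq_signProj ▸ signProj_mem hP 1
  have hqP' : 1 - qProj ∈ P := one_sub_qProj_eq_signProj ▸ signProj_mem hP (-1)
  have split : ∀ x : EllTwo AffineSL2Q →L[ℂ] EllTwo AffineSL2Q,
      x = qProj * x + (1 - qProj) * x := fun x => by rw [← add_mul, add_sub_cancel, one_mul]
  have split' : ∀ x : EllTwo AffineSL2Q →L[ℂ] EllTwo AffineSL2Q,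
      x = qProj * (qProj * x) + (1 - qProj) * ((1 - qProj) * x) := fun x => by
    rw [← mul_assoc, ← mul_assoc, hq, hq', ← split]
  have d1 := signProj_projVec_dichotomy hP hP' (σ := 1) (by norm_num)
  have d2 := signProj_projVec_dichotomy hP hP' (σ := -1) (by norm_num)
  have m1 : (∀ x ∈ P, qProj * x ∈ LSL2Q) ∨ (∀ x ∈ crossedProduct, qProj * x ∈ P) := by
    rw [qProj_eq_signProj]
    exact d1.imp (fun h x hx => signProj_mul_mem_LSL2Q hP hP' h hx)
      (fun h x hx => signProj_mul_mem hP hP' h hx)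
  have m2 : (∀ x ∈ P, (1 - qProj) * x ∈ LSL2Q) ∨
      (∀ x ∈ crossedProduct, (1 - qProj) * x ∈ P) := by
    rw [one_sub_qProj_eq_signProj]
    exact d2.imp (fun h x hx => signProj_mul_mem_LSL2Q hP hP' h hx)
      (fun h x hx => signProj_mul_mem hP hP' h hx)
  -- The corners `q` and `1 - q` are independent. In the mixed cases `split'` writes `x` with
  -- components `q x` and `(1 - q) x`, each lying in the algebra assigned to its corner.
  rcases m1 with m1 | m1 <;> rcases m2 with m2 | m2
  · left
    refine le_antisymm (fun x hx => ?_) hP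
    rw [split x]
    exact add_mem (m1 x hx) (m2 x hx)
  · right; right; left
    ext x
    constructor
    · intro hx
      exact ⟨_, m1 x hx, _, hP' (mul_mem hqP' hx), split' x⟩
    · rintro ⟨y, hy, z, hz, rfl⟩
      exact add_mem (mul_mem hqP (hP hy)) (m2 z hz)
  · right; right; right
    ext x
    constructor
    · intro hx
      exact ⟨_, hP' (mul_mem hqP hx), _, m2 x hx, split' x⟩
    · rintro ⟨y, hy, z, hz, rfl⟩
      exact add_mem (m1 y hy) (mul_mem hqP' (hP hz))
  · right; left
    refine le_antisymm hP' (fun x hx => ?_)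
    rw [split x]
    exact add_mem (m1 x hx) (m2 x hx)
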